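/- Let $V$ and $H$ be Hilbert spaces (both complex or both real), with $V$ continuously embedded and dense in $H$, and let $m\ge 1$ be an integer. For $\theta\in(0,1)$ let $[H,V]_\theta$ denote the complex interpolation space (for real spaces, the space of those $x\in H$ that belong to the complex interpolation space of the complexified couple, with the norm of the latter). For $0<\tau<\infty$ let $$Z^m(0,\tau)=\Big\{f\in L^2(0,\tau;V):\ \frac{d^mf}{dt^m}\in L^2(0,\tau;H)\Big\},\qquad \|f\|_{Z^m(0,\tau)}=\Big(\|f\|^2_{L^2(0,\tau;V)}+\Big\|\frac{d^mf}{dt^m}\Big\|^2_{L^2(0,\tau;H)}\Big)^{1/2},$$ with time derivatives in the sense of distributions, and let ${}_0Z^m(0,\tau)$ be the set of all $f\in Z^m(0,\tau)$ with $\frac{d^jf}{dt^j}(0)=0\in H$ for $j=0,1,\dots,m-1$ (values at points are those of the representative that is continuous on $[0,\tau]$ with values in $H$). Then there is a constant $k>0$, independent of $\tau$, such that for every $\tau\in(0,\infty)$, every $f\in{}_0Z^m(0,\tau)$ and every $j=0,1,\dots,m-1$, $$\frac{d^jf}{dt^j}\in C\big([0,\tau];[H,V]_{1-\frac{2j+1}{2m}}\big)\qquad\text{and}\qquad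 \sup_{t\in[0,\tau]}\Big\|\frac{d^jf}{dt^j}(t)\Big\|_{[H,V]_{1-\frac{2j+1}{2m}}}\le k\,\|f\|_{Z^m(0,\tau)}.$$ -/

import Mathlib

open MeasureTheory Set Filter Topology
open scoped ENNReal ContDiff

universe u v

noncomputable section

namespace TimeTrace

/-! ### Complex interpolation -/

section Complex

variable {H : Type u} {V : Type v}
  [NormedAddCommGroup H] [NormedSpace ℂ H] [NormedAddCommGroup V] [NormedSpace ℂ V]

/-- `F` belongs to Calderon's space of analytic functions on the strip `0 ≤ Re z ≤ 1` for the
couple `(H, V)`, where `V` is continuously embedded in `H` by `ι` (so that `H + V = H`):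
`F` is continuous and bounded on the closed strip with values in `H`, holomorphic in the open
strip, and its two boundary values `t ↦ F (i t)` and `t ↦ F (1 + i t) = ι (G t)` are continuous
into `H` and into `V` respectively, and vanish at infinity there. -/
structure IsCalderonFunction (ι : V →L[ℂ] H) (F : ℂ → H) (G : ℝ → V) : Prop where
  continuousOn : ContinuousOn F {z : ℂ | 0 ≤ z.re ∧ z.re ≤ 1}
  bounded : ∃ C : ℝ, ∀ z : ℂ, 0 ≤ z.re → z.re ≤ 1 → ‖F z‖ ≤ C
  holomorphic : DifferentiableOn ℂ F {z : ℂ | 0 < z.re ∧ z.re < 1}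
  tendsto_left : Tendsto (fun t : ℝ => F (t * Complex.I)) (cocompact ℝ) (𝓝 0)
  right_eq : ∀ t : ℝ, F (1 + t * Complex.I) = ι (G t)
  continuous_right : Continuous G
  tendsto_right : Tendsto G (cocompact ℝ) (𝓝 0)

/-- The norm of `x` in the complex interpolation space `[H, V]_θ`: the infimum of
`max (sup_t ‖F (i t)‖_H) (sup_t ‖F (1 + i t)‖_V)` over all `F` in Calderon's space with
`F θ = x`.  It is `∞` if there is no such `F`, so that `[H, V]_θ` is the set of all `x` for which
it is finite. -/
def interpNorm (ι : V →L[ℂ] H) (θ : ℝ) (x : H) : ℝ≥0∞ :=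
  ⨅ (F : ℂ → H) (G : ℝ → V) (_ : IsCalderonFunction ι F G) (_ : F (θ : ℂ) = x),
    max (⨆ t : ℝ, ‖F (t * Complex.I)‖ₑ) (⨆ t : ℝ, ‖G t‖ₑ)

end Complex

/-! ### Complexification, and complex interpolation of real spaces -/

/-- The complexification of a real inner product space: `toLp 2 (x, y)` stands for `x + i y`, and
`‖x + i y‖² = ‖x‖² + ‖y‖²`. -/
def Complexify (E : Type u) : Type u := WithLp 2 (E × E)

namespace Complexify

variable {E : Type u}

instance [NormedAddCommGroup E] : NormedAddCommGroup (Complexify E) :=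
  inferInstanceAs (NormedAddCommGroup (WithLp 2 (E × E)))

/-- The element `x + i y` of the complexification. -/
def mk (x y : E) : Complexify E := WithLp.toLp 2 (x, y)

/-- Real part. -/
def re (p : Complexify E) : E := (WithLp.ofLp p).1

/-- Imaginary part. -/
def im (p : Complexify E) : E := (WithLp.ofLp p).2

theorem ext' {p q : Complexify E} (h1 : re p = re q) (h2 : im p = im q) : p = q :=
  WithLp.ofLp_injective 2 (Prod.ext h1 h2)

variable [NormedAddCommGroup E]

theorem norm_sq (p : Complexify E) : ‖p‖ ^ 2 = ‖re p‖ ^ 2 + ‖im p‖ ^ 2 :=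
  WithLp.prod_norm_sq_eq_of_L2 (α := E) (β := E) p

theorem re_add (p q : Complexify E) : re (p + q) = re p + re q := rfl
theorem im_add (p q : Complexify E) : im (p + q) = im p + im q := rfl
theorem re_zero : re (0 : Complexify E) = 0 := rfl
theorem im_zero : im (0 : Complexify E) = 0 := rfl

variable [InnerProductSpace ℝ E]

instance : SMul ℂ (Complexify E) :=
  ⟨fun z p => mk (z.re • re p - z.im • im p) (z.re • im p + z.im • re p)⟩

theorem re_smul (z : ℂ) (p : Complexify E) : re (z • p) = z.re • re p - z.im • im p := rfl
theorem im_smul (z : ℂ) (p : Complexify E) : im (z • p) = z.re • im p + z.im • re p := rfl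

instance : Module ℂ (Complexify E) where
  one_smul p := by apply ext' <;> simp [re_smul, im_smul]
  mul_smul z w p := by
    apply ext' <;> simp only [re_smul, im_smul, Complex.mul_re, Complex.mul_im] <;> module
  smul_zero z := by apply ext' <;> simp [re_smul, im_smul, re_zero, im_zero]
  smul_add z p q := by
    apply ext' <;> simp only [re_smul, im_smul, re_add, im_add] <;> module
  add_smul z w p := by
    apply ext' <;> simp only [re_smul, im_smul, re_add, im_add, Complex.add_re, Complex.add_im] <;>
      module
  zero_smul p := by apply ext' <;> simp [re_smul, im_smul, re_zero, im_zero]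

instance : NormedSpace ℂ (Complexify E) where
  norm_smul_le z p := by
    refine le_of_eq ((sq_eq_sq₀ (norm_nonneg _) (by positivity)).1 ?_)
    rw [mul_pow, norm_sq, norm_sq, re_smul, im_smul, norm_sub_sq_real, norm_add_sq_real,
      Complex.sq_norm, Complex.normSq_apply]
    simp only [norm_smul, mul_pow, Real.norm_eq_abs, sq_abs, real_inner_smul_left,
      real_inner_smul_right, real_inner_comm (re p) (im p)]
    ring

variable {F : Type v} [NormedAddCommGroup F] [InnerProductSpace ℝ F]

/-- The complexification `x + i y ↦ L x + i L y` of a continuous real-linear map `L`. -/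
def map (L : F →L[ℝ] E) : Complexify F →L[ℂ] Complexify E :=
  LinearMap.mkContinuous
    { toFun := fun p => mk (L (re p)) (L (im p))
      map_add' := fun p q => by
        apply ext'
        · exact map_add L (re p) (re q)
        · exact map_add L (im p) (im q)
      map_smul' := fun z p => by
        apply ext'
        · change L (z.re • re p - z.im • im p) = z.re • L (re p) - z.im • L (im p)
          simp
        · change L (z.re • im p + z.im • re p) = z.re • L (im p) + z.im • L (re p)
          simp }
    ‖L‖
    (fun p => by
      refine (sq_le_sq₀ (norm_nonneg _) (by positivity)).1 ?_
      rw [mul_pow, norm_sq, norm_sq]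
      have h1 : ‖L (re p)‖ ^ 2 ≤ (‖L‖ * ‖re p‖) ^ 2 := by gcongr; exact L.le_opNorm _
      have h2 : ‖L (im p)‖ ^ 2 ≤ (‖L‖ * ‖im p‖) ^ 2 := by gcongr; exact L.le_opNorm _
      change ‖L (re p)‖ ^ 2 + ‖L (im p)‖ ^ 2 ≤ _
      linarith [mul_pow ‖L‖ ‖re p‖ 2, mul_pow ‖L‖ ‖im p‖ 2])

end Complexify

/-- The norm of `x` in `[H, V]_θ` for real Hilbert spaces: the norm of `x + i 0` in the complex
interpolation space of the complexified couple. -/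
def realInterpNorm {H : Type u} {V : Type v}
    [NormedAddCommGroup H] [InnerProductSpace ℝ H] [NormedAddCommGroup V] [InnerProductSpace ℝ V]
    (ι : V →L[ℝ] H) (θ : ℝ) (x : H) : ℝ≥0∞ :=
  interpNorm (Complexify.map ι) θ (Complexify.mk x 0)

/-! ### Functions of time -/

section Time

variable {H : Type u} {V : Type v}
  [NormedAddCommGroup H] [NormedSpace ℝ H] [NormedAddCommGroup V] [NormedSpace ℝ V]

/-- `g` is the `n`-th derivative of `w` on `(0, τ)` in the sense of distributions. -/
def IsWeakDeriv (n : ℕ) (τ : ℝ) (w g : ℝ → H) : Prop :=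
  LocallyIntegrableOn w (Ioo 0 τ) ∧ LocallyIntegrableOn g (Ioo 0 τ) ∧
  ∀ φ : ℝ → ℝ, ContDiff ℝ ∞ φ → HasCompactSupport φ → tsupport φ ⊆ Ioo 0 τ →
    ∫ t in Ioo 0 τ, iteratedDeriv n φ t • w t = (-1 : ℝ) ^ n • ∫ t in Ioo 0 τ, φ t • g t

/-- `f ∈ Z^m(0, τ)`: `f ∈ L²(0, τ; V)` and the distributional derivative `d^m f / dt^m` (of `f`
as an `H`-valued function) is in `L²(0, τ; H)`. -/
def MemZ (ι : V →L[ℝ] H) (m : ℕ) (τ : ℝ) (f : ℝ → V) : Prop :=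
  MemLp f 2 (volume.restrict (Ioo 0 τ)) ∧
  ∃ g : ℝ → H, MemLp g 2 (volume.restrict (Ioo 0 τ)) ∧ IsWeakDeriv m τ (fun t => ι (f t)) g

open Classical in
/-- The `n`-th distributional derivative on `(0, τ)` as a function (it is unique up to a null set),
and `0` if it is not a function. -/
def weakDeriv (n : ℕ) (τ : ℝ) (w : ℝ → H) : ℝ → H :=
  if h : ∃ g : ℝ → H, IsWeakDeriv n τ w g then h.choose else 0

/-- The norm `(‖f‖²_{L²(0,τ;V)} + ‖d^m f / dt^m‖²_{L²(0,τ;H)})^{1/2}` of `Z^m(0, τ)`. -/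
def zNorm (ι : V →L[ℝ] H) (m : ℕ) (τ : ℝ) (f : ℝ → V) : ℝ≥0∞ :=
  (eLpNorm f 2 (volume.restrict (Ioo 0 τ)) ^ 2 +
    eLpNorm (weakDeriv m τ (fun t => ι (f t))) 2 (volume.restrict (Ioo 0 τ)) ^ 2) ^ (1 / 2 : ℝ)

/-- `w` is the representative of the distributional derivative `d^j f / dt^j` on `(0, τ)` that is
continuous on `[0, τ]` with values in `H`; its values on `[0, τ]` are determined by `f`. -/
def IsContinuousDeriv (ι : V →L[ℝ] H) (j : ℕ) (τ : ℝ) (f : ℝ → V) (w : ℝ → H) : Prop :=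
  ContinuousOn w (Icc 0 τ) ∧ IsWeakDeriv j τ (fun t => ι (f t)) w

/-- `f ∈ ₀Z^m(0, τ)`: `f ∈ Z^m(0, τ)` and `d^j f / dt^j (0) = 0 ∈ H` for `j = 0, …, m - 1`, where
the value at `0` is that of the continuous representative.  (Nothing is assumed here on the
existence of that representative.) -/
def MemZeroZ (ι : V →L[ℝ] H) (m : ℕ) (τ : ℝ) (f : ℝ → V) : Prop :=
  MemZ ι m τ f ∧ ∀ j < m, ∀ w : ℝ → H, IsContinuousDeriv ι j τ f w → w 0 = 0

/-- `w ∈ C([0, τ]; X)`, for the subspace `X` of `H` on which the extended norm `N` is finite. -/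
def ContinuousInto (N : H → ℝ≥0∞) (τ : ℝ) (w : ℝ → H) : Prop :=
  ∀ t ∈ Icc 0 τ, N (w t) < ⊤ ∧ Tendsto (fun s => N (w s - w t)) (𝓝[Icc 0 τ] t) (𝓝 0)

end Time

end TimeTrace

end

open TimeTrace

/-! By polar decomposition, `ι` equals `S ^ m` up to contractions, where `S = (ι ι*) ^ (1 / (2 m))`
is a positive operator on `H` (`exists_positive_root`). Heuristically `V` is the domain of `S⁻ᵐ` and
`[H, V]_θ` that of `S ^ (-θ m)`. For `θ = 1 - (2 j + 1) / (2 m)` the exponent `θ m` is `m - j -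
1/2`, so the task is to bound `S ^ (-(m - j - 1/2)) u_j(t)`, with `u_j` the `j`-th derivative, by
the `L²` norms of `S⁻ᵐ u_0` and `u_m`.

This is an energy estimate. Put `a_i = ‖S ^ (-(m - i)) u_i‖_{L²}`. Since `u_j(0) = 0`, integrating
the derivative of the square of the wanted quantity bounds that square by `2 a_j a_{j+1}`. A second
integration by parts gives `a_i² ≤ 9 a_{i-1} a_{i+1}`, so every `a_i` is controlled by `a_0` and
`a_m`. There is no boundary term at `0`, hence the constants depend on `m` alone and not on `τ`. The
lemmas are `IsChain.sq_norm_le`, `IsChain.sq_chainNorm_le`, `le_max_of_sq_le_nine_mul` and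
`IsChain.norm_le`.

As `S` need not be invertible, `S⁻¹` is replaced by `(S + ε)⁻¹`, whose complex powers are `exp (w
L)` with `L = log (S + ε)` bounded. The energy estimate then controls `J u_j(t)`, where `J = (S (S +
ε)⁻¹) ^ m`, through an explicit Calderon function (`interpNorm_regularized_le`). Along `ε = 1 / (n +
1)` the contractions `J_n` tend strongly to the identity. The same estimate applied to `(1 - J_n) u`
makes `J_n u_j` Cauchy in the interpolation norm, uniformly in `t`, and completeness of the
interpolation space gives both the bound and the continuity. The real case follows by
complexification. -/

namespace TimeTrace

/-! ### Integration by parts -/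

section Parts

variable {E F G : Type*} [NormedAddCommGroup E] [NormedSpace ℝ E] [CompleteSpace E]
  [NormedAddCommGroup F] [NormedSpace ℝ F] [CompleteSpace F]
  [NormedAddCommGroup G] [NormedSpace ℝ G] [CompleteSpace G]

/-- Integration by parts for a bilinear map and primitives of integrable functions. -/
theorem integral_bilin_primitive_add (B : E →L[ℝ] F →L[ℝ] G) {T : ℝ} (hT : 0 ≤ T)
    {a : ℝ → E} {b : ℝ → F} (ha : IntegrableOn a (Ioc 0 T)) (hb : IntegrableOn b (Ioc 0 T)) :
    (∫ s in Ioc 0 T, B (a s) (∫ r in 0..s, b r)) + ∫ s in Ioc 0 T, B (∫ r in 0..s, a r) (b s) =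
      B (∫ s in 0..T, a s) (∫ s in 0..T, b s) := by
  set μ := volume.restrict (Ioc 0 T) with hμ
  have hp : Integrable (fun z : ℝ × ℝ => B (a z.1) (b z.2)) (μ.prod μ) :=
    ha.op_fst_snd (op := fun x y => B x y) (by fun_prop) ⟨‖B‖, B.le_opNorm₂⟩ hb
  have hS : MeasurableSet {z : ℝ × ℝ | z.2 ≤ z.1} := measurableSet_le measurable_snd measurable_fst
  -- The right side is an integral over the square. It is split along the diagonal, and Fubini in
  -- each triangle gives one of the two terms on the left.
  rw [intervalIntegral.integral_of_le hT, intervalIntegral.integral_of_le hT,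
    ← integral_prod_bilin B ha hb, ← integral_add_compl hS hp]
  · congr 1
    · rw [← integral_indicator hS, integral_prod _ (hp.indicator hS)]
      refine setIntegral_congr_fun measurableSet_Ioc fun s hs => ?_
      have h1 : ∀ r, {z : ℝ × ℝ | z.2 ≤ z.1}.indicator (fun z => B (a z.1) (b z.2)) (s, r) =
          (Iic s).indicator (fun r => B (a s) (b r)) r := fun r => by
        by_cases h : r ≤ s <;> simp [indicator, h]
      simp only [h1]
      have h2 : Iic s ∩ Ioc 0 T = Ioc 0 s := by
        ext r; simp only [mem_inter_iff, mem_Iic, mem_Ioc] at hs ⊢; grind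
      rw [integral_indicator measurableSet_Iic, hμ, Measure.restrict_restrict measurableSet_Iic, h2,
        intervalIntegral.integral_of_le hs.1.le]
      exact ((B (a s)).integral_comp_comm (hb.mono_set (Ioc_subset_Ioc_right hs.2))).symm
    · rw [← integral_indicator hS.compl, integral_prod_symm _ (hp.indicator hS.compl)]
      refine setIntegral_congr_fun measurableSet_Ioc fun s hs => ?_
      have h1 : ∀ r, {z : ℝ × ℝ | z.2 ≤ z.1}ᶜ.indicator (fun z => B (a z.1) (b z.2)) (r, s) =
          (Iio s).indicator (fun r => B.flip (b s) (a r)) r := fun r => by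
        by_cases h : s ≤ r
        · simp [indicator, h, not_lt.2 h]
        · simp [indicator, h, not_le.1 h]
      simp only [h1]
      have h2 : Iio s ∩ Ioc 0 T = Ioo 0 s := by
        ext r; simp only [mem_inter_iff, mem_Iio, mem_Ioo, mem_Ioc] at hs ⊢; grind
      rw [integral_indicator measurableSet_Iio, hμ, Measure.restrict_restrict measurableSet_Iio, h2,
        intervalIntegral.integral_of_le hs.1.le, ← integral_Ioc_eq_integral_Ioo]
      exact ((B.flip (b s)).integral_comp_comm (ha.mono_set (Ioc_subset_Ioc_right hs.2))).symm

end Parts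

/-! ### Weak derivatives and their continuous representatives -/

section WeakDeriv

variable {H : Type*} [NormedAddCommGroup H] [NormedSpace ℝ H]

/-- The product of a locally integrable function and a continuous function with compact support. -/
theorem integrable_smul_of_tsupport_subset {U : Set ℝ} {φ : ℝ → ℝ} {f : ℝ → H}
    (hφ : Continuous φ) (hc : HasCompactSupport φ) (hs : tsupport φ ⊆ U)
    (hf : LocallyIntegrableOn f U) : Integrable (fun t => φ t • f t) := by
  have h1 : IntegrableOn f (tsupport φ) := hf.integrableOn_compact_subset hs hc
  have h2 : IntegrableOn (fun t => φ t • f t) (tsupport φ) :=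
    h1.continuousOn_smul hφ.continuousOn hc
  rw [← integrableOn_iff_integrable_of_support_subset (s := tsupport φ)]
  · exact h2
  · intro x hx
    apply subset_tsupport
    intro h; simp [h] at hx

theorem IsWeakDeriv.ae_eq [CompleteSpace H] {n : ℕ} {τ : ℝ} {w g g' : ℝ → H}
    (h : IsWeakDeriv n τ w g) (h' : IsWeakDeriv n τ w g') :
    g =ᵐ[volume.restrict (Ioo 0 τ)] g' := by
  have := IsOpen.ae_eq_zero_of_integral_contDiff_smul_eq_zero (μ := volume) isOpen_Ioo
    (h.2.1.sub h'.2.1) (fun φ hφ hc hs => ?_)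
  · rw [Filter.EventuallyEq, ae_restrict_iff' measurableSet_Ioo]
    filter_upwards [this] with x hx hxm using sub_eq_zero.1 (hx hxm)
  · have key2 : ∀ f : ℝ → H, ∫ t in Ioo 0 τ, φ t • f t = ∫ t, φ t • f t := fun f =>
      setIntegral_eq_integral_of_forall_compl_eq_zero fun x hx => by
        rw [image_eq_zero_of_notMem_tsupport (fun h => hx (hs h)), zero_smul]
    have e1 := h.2.2 φ hφ hc hs
    rw [h'.2.2 φ hφ hc hs, key2, key2] at e1
    have e2 : ∫ t, φ t • g' t = ∫ t, φ t • g t := by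
      have : ((-1 : ℝ) ^ n) ≠ 0 := by positivity
      exact smul_right_injective H this e1
    simp only [Pi.sub_apply, smul_sub]
    rw [integral_sub (integrable_smul_of_tsupport_subset hφ.continuous hc hs h.2.1)
      (integrable_smul_of_tsupport_subset hφ.continuous hc hs h'.2.1), e2, sub_self]

theorem tsupport_iteratedDeriv_subset (φ : ℝ → ℝ) (n : ℕ) :
    tsupport (iteratedDeriv n φ) ⊆ tsupport φ := by
  induction n with
  | zero => simp
  | succ n ih =>
    rw [iteratedDeriv_succ]
    exact (closure_minimal support_deriv_subset (isClosed_tsupport _)).trans ih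

/-- A test function with mean zero is the derivative of a test function. -/
theorem exists_primitive_testFunction {τ : ℝ} {η : ℝ → ℝ} (hη : ContDiff ℝ ∞ η)
    (hc : HasCompactSupport η) (hs : tsupport η ⊆ Ioo 0 τ) (h0 : ∫ t, η t = 0) :
    ContDiff ℝ ∞ (fun t => ∫ s in 0..t, η s) ∧ HasCompactSupport (fun t => ∫ s in 0..t, η s) ∧
      tsupport (fun t => ∫ s in 0..t, η s) ⊆ Ioo 0 τ ∧
      deriv (fun t => ∫ s in 0..t, η s) = η ∧ (∫ s in 0..τ, η s) = 0 := by
  obtain hemp | hne := (tsupport η).eq_empty_or_nonempty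
  · have : η = 0 := tsupport_eq_empty_iff.1 hemp
    subst this
    have h0 : (fun t : ℝ => ∫ s in 0..t, (0 : ℝ → ℝ) s) = fun _ => 0 := by ext; simp
    rw [h0]
    refine ⟨contDiff_const, HasCompactSupport.zero, ?_, ?_, by simp⟩
    · have : tsupport (fun _ : ℝ => (0 : ℝ)) = ∅ := tsupport_eq_empty_iff.2 rfl
      simp [this]
    · ext; simp
  set a := sInf (tsupport η)
  set b := sSup (tsupport η)
  have ha : a ∈ Ioo 0 τ := hs (IsCompact.sInf_mem hc hne)
  have hb : b ∈ Ioo 0 τ := hs (IsCompact.sSup_mem hc hne)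
  have hab : tsupport η ⊆ Icc a b := fun x hx =>
    ⟨csInf_le hc.bddBelow hx, le_csSup hc.bddAbove hx⟩
  have hd : ∀ t, HasDerivAt (fun t => ∫ s in 0..t, η s) (η t) t := fun t =>
    (hη.continuous.integral_hasStrictDerivAt 0 t).hasDerivAt
  have hd' : deriv (fun t => ∫ s in 0..t, η s) = η := funext fun t => (hd t).deriv
  have hz : ∀ x, x ∉ Icc a b → η x = 0 := fun x hx =>
    image_eq_zero_of_notMem_tsupport fun h => hx (hab h)
  have hbig : ∀ t, b ≤ t → ∫ s in 0..t, η s = 0 := by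
    intro t ht
    refine Eq.trans ?_ h0
    rw [intervalIntegral.integral_of_le (hb.1.le.trans ht)]
    refine setIntegral_eq_integral_of_forall_compl_eq_zero fun x hx => hz x fun h => hx ?_
    exact ⟨ha.1.trans_le h.1, h.2.trans ht⟩
  have hsmall : ∀ t, t < a → ∫ s in 0..t, η s = 0 := by
    intro t ht
    refine intervalIntegral.integral_zero_ae (Eventually.of_forall fun x hx => hz x fun h => ?_)
    rw [uIoc, mem_Ioc] at hx
    exact absurd h.1 (not_le.2 (hx.2.trans_lt (max_lt ha.1 ht)))
  have hts : tsupport (fun t => ∫ s in 0..t, η s) ⊆ Icc a b := by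
    refine closure_minimal (fun t ht => ?_) isClosed_Icc
    by_contra h
    rw [mem_Icc, not_and_or, not_le, not_le] at h
    exact ht (h.elim (hsmall t) fun h => hbig t h.le)
  refine ⟨?_, HasCompactSupport.of_support_subset_isCompact isCompact_Icc
    ((subset_tsupport _).trans hts), hts.trans fun x hx => ⟨ha.1.trans_le hx.1, hx.2.trans_lt hb.2⟩,
    hd', hbig τ hb.2.le⟩
  exact contDiff_infty_iff_deriv.2 ⟨fun t => (hd t).differentiableAt, by rwa [hd']⟩

theorem continuousOn_primitive_Icc {τ : ℝ} (hτ : 0 ≤ τ) {g : ℝ → H}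
    (hg : IntegrableOn g (Ioc 0 τ)) : ContinuousOn (fun t => ∫ s in 0..t, g s) (Icc 0 τ) := by
  have := intervalIntegral.continuousOn_primitive_interval (a := 0) (b := τ) (f := g)
    (μ := volume) (by rw [uIcc_of_le hτ, integrableOn_Icc_iff_integrableOn_Ioc]; exact hg)
  rwa [uIcc_of_le hτ] at this

/-- If the derivative of order `n + 1` of `w` is an integrable function, then the derivative of
order `n` is a primitive of it. -/
theorem IsWeakDeriv.exists_primitive [CompleteSpace H] {n : ℕ} {τ : ℝ} (hτ : 0 < τ) {w g : ℝ → H}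
    (h : IsWeakDeriv (n + 1) τ w g) (hg : IntegrableOn g (Ioc 0 τ)) :
    ∃ c : H, IsWeakDeriv n τ w (fun t => c + ∫ s in 0..t, g s) := by
  set Γ : ℝ → H := fun t => ∫ s in 0..t, g s with hΓ
  have hΓc : ContinuousOn Γ (Icc 0 τ) := continuousOn_primitive_Icc hτ.le hg
  have hΓl : LocallyIntegrableOn Γ (Ioo 0 τ) :=
    (hΓc.mono Ioo_subset_Icc_self).locallyIntegrableOn measurableSet_Ioo
  have hcl : ∀ c : H, LocallyIntegrableOn (fun _ => c) (Ioo 0 τ) := fun c =>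
    continuousOn_const.locallyIntegrableOn measurableSet_Ioo
  -- The normalized bump `ψ` has integral one and support `[τ/4, 3τ/4]`. Subtracting `(∫ φ) ψ` from
  -- a test function `φ` leaves one of mean zero, which is the derivative of a test function.
  let β : ContDiffBump (τ / 2) := ⟨τ / 8, τ / 4, by positivity, by linarith⟩
  let ψ : ℝ → ℝ := β.normed volume
  have hψ : ContDiff ℝ ∞ ψ := β.contDiff_normed
  have hψc : HasCompactSupport ψ := β.hasCompactSupport_normed
  have hψs : tsupport ψ ⊆ Ioo 0 τ := by
    rw [β.tsupport_normed_eq, Real.closedBall_eq_Icc]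
    intro x hx
    have : β.rOut = τ / 4 := rfl
    rw [this, mem_Icc] at hx
    constructor <;> linarith [hx.1, hx.2]
  have hψ1 : ∫ t, ψ t = 1 := β.integral_normed
  have hI : ∀ {φ : ℝ → ℝ} {f : ℝ → H}, tsupport φ ⊆ Ioo 0 τ →
      ∫ t in Ioo 0 τ, φ t • f t = ∫ t, φ t • f t := fun hs =>
    setIntegral_eq_integral_of_forall_compl_eq_zero fun x hx => by
      rw [image_eq_zero_of_notMem_tsupport (fun h => hx (hs h)), zero_smul]
  -- The only value of `c` for which the required identity holds when tested against `ψ`.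
  set c : H := (-1 : ℝ) ^ n • (∫ t, iteratedDeriv n ψ t • w t) - ∫ t, ψ t • Γ t with hc
  refine ⟨c, h.1, (hcl c).add hΓl, fun φ hφ hφc hφs => ?_⟩
  set I := ∫ t, φ t
  set η : ℝ → ℝ := fun t => φ t - I * ψ t
  have hη : ContDiff ℝ ∞ η := hφ.sub (contDiff_const.mul hψ)
  have hηs' : tsupport η ⊆ tsupport φ ∪ tsupport ψ := by
    refine closure_minimal (fun t ht => ?_) ((isClosed_tsupport _).union (isClosed_tsupport _))
    by_contra hh
    rw [mem_union, not_or] at hh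
    apply ht
    simp only [η, image_eq_zero_of_notMem_tsupport hh.1, image_eq_zero_of_notMem_tsupport hh.2]
    ring
  have hηs := hηs'.trans (union_subset hφs hψs)
  have hηc : HasCompactSupport η :=
    (IsCompact.union hφc hψc).of_isClosed_subset (isClosed_tsupport _) hηs'
  have hη0 : ∫ t, η t = 0 := by
    simp only [η]
    rw [integral_sub (hφ.continuous.integrable_of_hasCompactSupport hφc)
      ((hψ.continuous.integrable_of_hasCompactSupport hψc).const_mul I), integral_const_mul, hψ1]
    simp [I]
  obtain ⟨x1, x2, x3, x4, x5⟩ := exists_primitive_testFunction hη hηc hηs hη0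
  have key := h.2.2 _ x1 x2 x3
  rw [iteratedDeriv_succ', x4] at key
  -- The boundary term vanishes because the primitive of `η` is zero at `τ` (`x5`).
  have hparts := integral_bilin_primitive_add (ContinuousLinearMap.lsmul ℝ ℝ (E := H)) hτ.le
    (hη.continuous.integrableOn_Ioc (a := 0) (b := τ)) hg
  simp only [ContinuousLinearMap.lsmul_apply, x5, zero_smul] at hparts
  rw [integral_Ioc_eq_integral_Ioo, integral_Ioc_eq_integral_Ioo, hI hηs] at hparts
  rw [← neg_eq_of_add_eq_zero_right hparts, pow_succ, mul_neg_one, neg_smul, smul_neg,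
    neg_neg] at key
  have hsub : ∀ {φ : ℝ → ℝ} (n : ℕ), HasCompactSupport φ → tsupport φ ⊆ Ioo 0 τ →
      ContDiff ℝ ∞ φ → Continuous (iteratedDeriv n φ) ∧
      HasCompactSupport (iteratedDeriv n φ) ∧ tsupport (iteratedDeriv n φ) ⊆ Ioo 0 τ := by
    intro φ n h1 h2 h3
    exact ⟨h3.continuous_iteratedDeriv n (by exact_mod_cast le_top),
      IsCompact.of_isClosed_subset h1 (isClosed_tsupport _) (tsupport_iteratedDeriv_subset φ n),
      (tsupport_iteratedDeriv_subset φ n).trans h2⟩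
  obtain ⟨a1, a2, a3⟩ := hsub n hφc hφs hφ
  obtain ⟨b1, b2, b3⟩ := hsub n hψc hψs hψ
  have hηn : ∀ t, iteratedDeriv n η t = iteratedDeriv n φ t - I * iteratedDeriv n ψ t := by
    intro t
    have hn : (n : WithTop ℕ∞) ≤ ((⊤ : ℕ∞) : WithTop ℕ∞) := by exact_mod_cast le_top
    rw [iteratedDeriv_fun_sub (hφ.contDiffAt.of_le hn)
      ((contDiff_const.mul hψ).contDiffAt.of_le hn), iteratedDeriv_const_mul_field]
  rw [hI (hsub n hηc hηs hη).2.2] at key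
  simp only [hηn, sub_smul, mul_smul] at key
  have j1 : Integrable (fun t => I • iteratedDeriv n ψ t • w t) :=
    (integrable_smul_of_tsupport_subset b1 b2 b3 h.1).smul I
  have j2 : Integrable (fun t => I • ψ t • Γ t) :=
    (integrable_smul_of_tsupport_subset hψ.continuous hψc hψs hΓl).smul I
  have j3 : ∀ t, η t • Γ t = φ t • Γ t - I • ψ t • Γ t := fun t => by
    simp only [η, sub_smul, mul_smul]
  change _ = (-1 : ℝ) ^ n • ∫ t, η t • Γ t at key
  rw [integral_sub (integrable_smul_of_tsupport_subset a1 a2 a3 h.1) j1, integral_smul] at key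
  simp only [j3] at key
  rw [integral_sub (integrable_smul_of_tsupport_subset hφ.continuous hφc hφs hΓl) j2,
    integral_smul] at key
  rw [hI a3, hI hφs]
  change _ = (-1 : ℝ) ^ n • ∫ t, φ t • (c + Γ t)
  simp only [smul_add]
  rw [integral_add (integrable_smul_of_tsupport_subset hφ.continuous hφc hφs (hcl c))
    (integrable_smul_of_tsupport_subset hφ.continuous hφc hφs hΓl), integral_smul_const]
  rw [sub_eq_iff_eq_add] at key
  rw [key, hc]
  have hs : ∀ x : H, (-1 : ℝ) ^ n • (-1 : ℝ) ^ n • x = x := fun x => by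
    rw [smul_smul, ← mul_pow]; simp
  simp only [smul_sub, smul_add]
  rw [smul_comm ((-1 : ℝ) ^ n) I ((-1 : ℝ) ^ n • _), hs]
  module

/-- The functions `u 0, …, u m` are successive derivatives on `(0, τ)`, with `u m` in `L²` and
`u 0, …, u (m - 1)` vanishing at `0`. -/
structure IsChain (m : ℕ) (τ : ℝ) (u : ℕ → ℝ → H) : Prop where
  memLp : MemLp (u m) 2 (volume.restrict (Ioo 0 τ))
  eq_primitive : ∀ j < m, ∀ t ∈ Icc 0 τ, u j t = ∫ s in 0..t, u (j + 1) s

theorem IsChain.integrableOn {m : ℕ} {τ : ℝ} {u : ℕ → ℝ → H} (hτ : 0 ≤ τ) (h : IsChain m τ u)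
    {j : ℕ} (hj : j ≤ m) : IntegrableOn (u j) (Ioc 0 τ) := by
  obtain ⟨k, rfl⟩ := Nat.exists_eq_add_of_le hj
  induction k generalizing j with
  | zero =>
    have := h.memLp.integrable (by norm_num)
    rwa [add_zero, ← IntegrableOn, ← integrableOn_Ioc_iff_integrableOn_Ioo] at this
  | succ k ih =>
    have h1 : IntegrableOn (u (j + 1)) (Ioc 0 τ) := by
      rw [← Nat.add_assoc, Nat.add_right_comm] at h
      exact ih h (by omega)
    exact (((continuousOn_primitive_Icc hτ h1).congr (h.eq_primitive j (by omega))
      ).integrableOn_compact isCompact_Icc).mono_set Ioc_subset_Icc_self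

theorem IsChain.continuousOn {m : ℕ} {τ : ℝ} {u : ℕ → ℝ → H} (hτ : 0 ≤ τ) (h : IsChain m τ u)
    {j : ℕ} (hj : j < m) : ContinuousOn (u j) (Icc 0 τ) := by
  exact (continuousOn_primitive_Icc hτ (h.integrableOn hτ hj)).congr (h.eq_primitive j hj)

theorem IsChain.mono {m : ℕ} {τ t : ℝ} {u : ℕ → ℝ → H} (h : IsChain m τ u) (ht : t ≤ τ) :
    IsChain m t u :=
  ⟨h.memLp.mono_measure (Measure.restrict_mono (Ioo_subset_Ioo_right ht) le_rfl),
    fun j hj s hs => h.eq_primitive j hj s ⟨hs.1, hs.2.trans ht⟩⟩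

theorem IsChain.map [CompleteSpace H] {H' : Type*} [NormedAddCommGroup H'] [NormedSpace ℝ H']
    [CompleteSpace H'] {m : ℕ} {τ : ℝ} {u : ℕ → ℝ → H} (h : IsChain m τ u) (hτ : 0 ≤ τ)
    (T : H →L[ℝ] H') : IsChain m τ (fun j t => T (u j t)) := by
  refine ⟨T.comp_memLp' h.memLp, fun j hj t ht => ?_⟩
  rw [h.eq_primitive j hj t ht, T.intervalIntegral_comp_comm]
  rw [intervalIntegrable_iff_integrableOn_Ioc_of_le ht.1]
  exact (h.integrableOn hτ hj).mono_set (Ioc_subset_Ioc_right ht.2)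

theorem isWeakDeriv_zero {τ : ℝ} {w : ℝ → H} (hw : LocallyIntegrableOn w (Ioo 0 τ)) :
    IsWeakDeriv 0 τ w w :=
  ⟨hw, hw, fun φ _ _ _ => by simp⟩

variable {V : Type*} [NormedAddCommGroup V] [NormedSpace ℝ V]

/-- The chain consists of the iterated primitives from `0` of the top derivative. Descending from
order `m`, the derivative of order `j` is the iterated primitive plus a constant; this is a
continuous representative, so the initial condition makes the constant zero. Existence of the
representatives is thus obtained along the way. -/
theorem MemZeroZ.exists_chain [CompleteSpace H] {ι : V →L[ℝ] H} {m : ℕ} {τ : ℝ} {f : ℝ → V}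
    (hτ : 0 < τ) (h : MemZeroZ ι m τ f) :
    ∃ u : ℕ → ℝ → H, IsChain m τ u ∧ ∀ j ≤ m, IsWeakDeriv j τ (fun t => ι (f t)) (u j) := by
  obtain ⟨⟨-, g, hg, hwg⟩, h0⟩ := h
  let P : (ℝ → H) → ℝ → H := fun v t => ∫ s in 0..t, v s
  have hP : ∀ j < m, P^[m - j] g = P (P^[m - (j + 1)] g) := fun j hj => by
    rw [← Function.iterate_succ_apply' P]; congr 2; omega
  have hch : IsChain m τ (fun j => P^[m - j] g) :=
    ⟨by simpa using hg, fun j hj t _ => by rw [hP j hj]⟩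
  refine ⟨fun j => P^[m - j] g, hch, fun j hj => ?_⟩
  induction hj using Nat.decreasingInduction with
  | self => simpa using hwg
  | of_succ j hj ih =>
    obtain ⟨c, hc⟩ := ih.exists_primitive hτ (hch.integrableOn hτ.le hj)
    have hc' : IsWeakDeriv j τ (fun t => ι (f t)) (fun t => c + (P^[m - j] g) t) := by
      rw [hP j hj]; exact hc
    have := h0 j hj _ ⟨continuousOn_const.add (hch.continuousOn hτ.le hj), hc'⟩
    rw [hP j hj] at this
    have hc0 : c = 0 := by simpa [P] using this
    simpa [hc0] using hc'

theorem eLpNorm_le_zNorm [CompleteSpace H] {ι : V →L[ℝ] H} {m : ℕ} {τ : ℝ} {f : ℝ → V} {g : ℝ → H}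
    (h : IsWeakDeriv m τ (fun t => ι (f t)) g) :
    eLpNorm f 2 (volume.restrict (Ioo 0 τ)) ≤ zNorm ι m τ f ∧
      eLpNorm g 2 (volume.restrict (Ioo 0 τ)) ≤ zNorm ι m τ f := by
  have hex : ∃ g : ℝ → H, IsWeakDeriv m τ (fun t => ι (f t)) g := ⟨g, h⟩
  have hw : IsWeakDeriv m τ (fun t => ι (f t)) (weakDeriv m τ (fun t => ι (f t))) := by
    rw [weakDeriv, dif_pos hex]; exact hex.choose_spec
  rw [eLpNorm_congr_ae (h.ae_eq hw), zNorm]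
  have key : ∀ x : ℝ≥0∞, (x ^ 2) ^ (1 / 2 : ℝ) = x := fun x => by
    rw [← ENNReal.rpow_natCast, ← ENNReal.rpow_mul]; norm_num
  constructor
  · conv_lhs => rw [← key (eLpNorm f 2 _)]
    gcongr
    exact le_self_add
  · conv_lhs => rw [← key (eLpNorm (weakDeriv _ _ _) 2 _)]
    gcongr
    exact le_add_self

end WeakDeriv

/-- A finite sequence that is log-convex up to the constant `9` is controlled by its end terms. -/
theorem le_max_of_sq_le_nine_mul {m : ℕ} {a : ℕ → ℝ} (ha : ∀ i, 0 ≤ a i)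
    (h : ∀ i, 1 ≤ i → i < m → a i ^ 2 ≤ 9 * (a (i - 1) * a (i + 1))) {j : ℕ} (hj : j ≤ m) :
    a j ≤ 3 ^ (m ^ 2) * max (a 0) (a m) := by
  -- Since `(i - 1)² + (i + 1)² - 2 i² = 2`, this weight absorbs the factor `9 = 3²`, and `b` is
  -- log-convex.
  set b : ℕ → ℝ := fun i => 3 ^ (i ^ 2) * a i
  have hb0 : ∀ i, 0 ≤ b i := fun i => by have := ha i; positivity
  have hb : ∀ i, 1 ≤ i → i < m → b i ^ 2 ≤ b (i - 1) * b (i + 1) := by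
    intro i h1 h2
    obtain ⟨k, rfl⟩ := Nat.exists_eq_add_of_le' h1
    have := h (k + 1) h1 h2
    simp only [Nat.add_sub_cancel, b] at this ⊢
    calc (3 ^ (k + 1) ^ 2 * a (k + 1)) ^ 2 = 3 ^ (2 * (k + 1) ^ 2) * a (k + 1) ^ 2 := by
          rw [mul_pow, ← pow_mul, mul_comm 2]
      _ ≤ 3 ^ (2 * (k + 1) ^ 2) * (9 * (a k * a (k + 1 + 1))) := by gcongr
      _ = 3 ^ k ^ 2 * a k * (3 ^ (k + 1 + 1) ^ 2 * a (k + 1 + 1)) := by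
          have : (9 : ℝ) = 3 ^ 2 := by norm_num
          have e : (3 : ℝ) ^ (2 * (k + 1) ^ 2) * 3 ^ 2 = 3 ^ k ^ 2 * 3 ^ (k + 1 + 1) ^ 2 := by
            rw [← pow_add, ← pow_add]; congr 1; ring
          rw [this]; linear_combination (a k * a (k + 1 + 1)) * e
  have hmax : ∀ i ≤ m, b i ≤ max (b 0) (b m) := by
    obtain ⟨i₀, hi₀, hM⟩ := Finset.exists_max_image (Finset.range (m + 1)) b ⟨0, by simp⟩
    -- The first index at which the maximum is attained cannot be interior: there `b (i - 1) < b i`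
    -- and `b (i + 1) ≤ b i` contradict log-convexity.
    have hex : ∃ i, i ≤ m ∧ b i = b i₀ := ⟨i₀, by simpa [Nat.lt_succ_iff] using hi₀, rfl⟩
    classical
    obtain ⟨h1, h2⟩ := Nat.find_spec hex
    set i := Nat.find hex
    have hM' : ∀ k ≤ m, b k ≤ b i := fun k hk => by
      rw [h2]; exact hM k (by simpa [Nat.lt_succ_iff] using hk)
    suffices b i ≤ max (b 0) (b m) from fun k hk => (hM' k hk).trans this
    rcases Nat.eq_zero_or_pos i with h0 | h0
    · rw [h0]; exact le_max_left _ _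
    rcases h1.eq_or_lt with h3 | h3
    · rw [h3]; exact le_max_right _ _
    have h4 : b (i - 1) < b i := lt_of_le_of_ne (hM' _ (by omega)) fun h =>
      Nat.find_min hex (show i - 1 < i by omega) ⟨by omega, h.trans h2⟩
    nlinarith [hb i h0 h3, hM' (i + 1) h3, hb0 (i - 1), hb0 (i + 1), hb0 i]
  have h3 : ∀ i, (1 : ℝ) ≤ 3 ^ i ^ 2 := fun i => one_le_pow₀ (by norm_num)
  calc a j ≤ b j := le_mul_of_one_le_left (ha j) (h3 j)
    _ ≤ max (b 0) (b m) := hmax j hj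
    _ ≤ 3 ^ (m ^ 2) * max (a 0) (a m) := by
      refine max_le ?_ ?_
      · have : b 0 = a 0 := by simp [b]
        rw [this]
        exact (le_max_left _ _).trans (le_mul_of_one_le_left ((ha 0).trans (le_max_left _ _)) (h3 m))
      · exact mul_le_mul_of_nonneg_left (le_max_right _ _) (by positivity)

/-! ### Energy estimates in `L²` -/

section L2

variable {H : Type*} [NormedAddCommGroup H] [InnerProductSpace ℝ H]

theorem abs_integral_inner_le {μ : Measure ℝ} {x y : ℝ → H} (hx : MemLp x 2 μ) (hy : MemLp y 2 μ) :
    |∫ s, inner ℝ (x s) (y s) ∂μ| ≤ (eLpNorm x 2 μ).toReal * (eLpNorm y 2 μ).toReal := by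
  have := abs_real_inner_le_norm (hx.toLp x) (hy.toLp y)
  rw [L2.inner_def, Lp.norm_toLp, Lp.norm_toLp] at this
  rwa [integral_congr_ae] at this
  filter_upwards [hx.coeFn_toLp, hy.coeFn_toLp] with s h1 h2
  rw [h1, h2]

theorem integral_inner_self_eq {μ : Measure ℝ} {x : ℝ → H} (hx : MemLp x 2 μ) :
    ∫ s, inner ℝ (x s) (x s) ∂μ = (eLpNorm x 2 μ).toReal ^ 2 := by
  have := real_inner_self_eq_norm_sq (hx.toLp x)
  rw [L2.inner_def, Lp.norm_toLp] at this
  rw [← this]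
  refine integral_congr_ae ?_
  filter_upwards [hx.coeFn_toLp] with s h1
  rw [h1]

end L2

section Energy

variable {H : Type*} [NormedAddCommGroup H] [InnerProductSpace ℝ H]

theorem IsChain.memLp_of_le {m : ℕ} {τ : ℝ} {u : ℕ → ℝ → H} (hτ : 0 ≤ τ) (h : IsChain m τ u)
    {j : ℕ} (hj : j ≤ m) : MemLp (u j) 2 (volume.restrict (Ioo 0 τ)) := by
  rcases hj.eq_or_lt with rfl | hj
  · exact h.memLp
  · obtain ⟨C, hC⟩ := isCompact_Icc.exists_bound_of_continuousOn (h.continuousOn hτ hj)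
    refine MemLp.of_bound ?_ C ?_
    · exact ((h.continuousOn hτ hj).mono Ioo_subset_Icc_self).aestronglyMeasurable
        measurableSet_Ioo
    · exact (ae_restrict_iff' measurableSet_Ioo).2 (Eventually.of_forall fun x hx =>
        hC x (Ioo_subset_Icc_self hx))

theorem inner_pow_apply_swap {R : H →L[ℝ] H} (hR : ∀ x y, inner ℝ (R x) y = inner ℝ x (R y))
    (n : ℕ) : ∀ x y, inner ℝ ((R ^ n) x) y = inner ℝ x ((R ^ n) y) := by
  induction n with
  | zero => simp
  | succ n ih =>
    intro x y
    rw [pow_succ, mul_apply_eq_comp, ih, hR, ← mul_apply_eq_comp,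
      ← pow_succ', pow_succ]

theorem inner_pow_apply_pow_apply {R : H →L[ℝ] H}
    (hR : ∀ x y, inner ℝ (R x) y = inner ℝ x (R y)) {p q r s : ℕ} (h : p + q = r + s) (x y : H) :
    inner ℝ ((R ^ p) x) ((R ^ q) y) = inner ℝ ((R ^ r) x) ((R ^ s) y) := by
  have key : ∀ p q, inner ℝ ((R ^ p) x) ((R ^ q) y) = inner ℝ x ((R ^ (p + q)) y) := fun p q => by
    rw [inner_pow_apply_swap hR, pow_add]; rfl
  rw [key, key, h]

/-- The `L²` norm of `R ^ (2 (m - i)) u_i`. -/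
noncomputable def chainNorm (m : ℕ) (τ : ℝ) (R : H →L[ℝ] H) (u : ℕ → ℝ → H) (i : ℕ) : ℝ :=
  (eLpNorm (fun s => (R ^ (2 * (m - i))) (u i s)) 2 (volume.restrict (Ioo 0 τ))).toReal

variable [CompleteSpace H]

theorem IsChain.parts {m : ℕ} {τ : ℝ} {u : ℕ → ℝ → H} (hτ : 0 ≤ τ) (h : IsChain m τ u)
    (A : H →L[ℝ] H) {i j : ℕ} (hi : i < m) (hj : j < m) :
    (∫ s in Ioo 0 τ, inner ℝ (A (u (i + 1) s)) (A (u j s))) +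
      ∫ s in Ioo 0 τ, inner ℝ (A (u i s)) (A (u (j + 1) s)) =
      inner ℝ (A (u i τ)) (A (u j τ)) := by
  have := integral_bilin_primitive_add ((innerSL ℝ (E := H)).bilinearComp A A) hτ
    (h.integrableOn hτ hi) (h.integrableOn hτ hj)
  rw [← h.eq_primitive i hi τ ⟨hτ, le_rfl⟩, ← h.eq_primitive j hj τ ⟨hτ, le_rfl⟩] at this
  rw [← integral_Ioc_eq_integral_Ioo, ← integral_Ioc_eq_integral_Ioo]
  refine Eq.trans (congrArg₂ _ ?_ ?_) this
  · refine setIntegral_congr_fun measurableSet_Ioc fun s hs => ?_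
    simp only [← h.eq_primitive j hj s ⟨hs.1.le, hs.2⟩]
    rfl
  · refine setIntegral_congr_fun measurableSet_Ioc fun s hs => ?_
    simp only [← h.eq_primitive i hi s ⟨hs.1.le, hs.2⟩]
    rfl

/-- The square at `τ` is the integral of its derivative, as `u j` vanishes at `0`. By symmetry of
`R` the total power `4 (m - j) - 2` is redistributed as `2 (m - j)` on `u j` and `2 (m - j - 1)` on
`u (j + 1)`, and Cauchy–Schwarz applies. -/
theorem IsChain.sq_norm_le {m : ℕ} {τ : ℝ} {u : ℕ → ℝ → H} (hτ : 0 ≤ τ) (h : IsChain m τ u)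
    {R : H →L[ℝ] H} (hR : ∀ x y, inner ℝ (R x) y = inner ℝ x (R y)) {j : ℕ} (hj : j < m) :
    ‖(R ^ (2 * (m - j) - 1)) (u j τ)‖ ^ 2 ≤
      2 * (chainNorm m τ R u j * chainNorm m τ R u (j + 1)) := by
  have hp := h.parts hτ (R ^ (2 * (m - j) - 1)) hj hj
  rw [real_inner_self_eq_norm_sq] at hp
  have h1 : ∀ x y, inner ℝ ((R ^ (2 * (m - j) - 1)) x) ((R ^ (2 * (m - j) - 1)) y) =
      inner ℝ ((R ^ (2 * (m - (j + 1)))) x) ((R ^ (2 * (m - j))) y) :=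
    inner_pow_apply_pow_apply hR (by omega)
  have h2 : ∀ x y, inner ℝ ((R ^ (2 * (m - j) - 1)) x) ((R ^ (2 * (m - j) - 1)) y) =
      inner ℝ ((R ^ (2 * (m - j))) x) ((R ^ (2 * (m - (j + 1)))) y) := fun x y => by
    rw [real_inner_comm, h1, real_inner_comm]
  simp only [h1 (u (j + 1) _) (u j _), h2 (u j _) (u (j + 1) _)] at hp
  have m1 := (R ^ (2 * (m - (j + 1)))).comp_memLp' (h.memLp_of_le hτ (j := j + 1) hj)
  have m0 := (R ^ (2 * (m - j))).comp_memLp' (h.memLp_of_le hτ hj.le)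
  have c1 := (le_abs_self _).trans (abs_integral_inner_le m1 m0)
  have c2 := (le_abs_self _).trans (abs_integral_inner_le m0 m1)
  simp only [Function.comp_apply] at c1 c2
  rw [← hp, chainNorm, chainNorm]
  simp only [Function.comp_def] at c1 c2
  linarith

/-- One derivative is moved from `u i` to its neighbour, leaving an integral of `u (i + 1)` against
`u (i - 1)` and a boundary term at `τ`. The boundary term is estimated by `IsChain.sq_norm_le` at
the two orders `i` and `i - 1`. -/
theorem IsChain.sq_chainNorm_le {m : ℕ} {τ : ℝ} {u : ℕ → ℝ → H} (hτ : 0 ≤ τ) (h : IsChain m τ u)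
    {R : H →L[ℝ] H} (hR : ∀ x y, inner ℝ (R x) y = inner ℝ x (R y)) {i : ℕ} (hi : 1 ≤ i)
    (him : i < m) :
    chainNorm m τ R u i ^ 2 ≤ 9 * (chainNorm m τ R u (i - 1) * chainNorm m τ R u (i + 1)) := by
  obtain ⟨k, rfl⟩ := Nat.exists_eq_add_of_le' hi
  rw [Nat.add_sub_cancel]
  have hp := h.parts hτ (R ^ (2 * (m - (k + 1)))) him (show k < m by omega)
  have h1 : ∀ x y, inner ℝ ((R ^ (2 * (m - (k + 1)))) x) ((R ^ (2 * (m - (k + 1)))) y) =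
      inner ℝ ((R ^ (2 * (m - (k + 1 + 1)))) x) ((R ^ (2 * (m - k))) y) :=
    inner_pow_apply_pow_apply hR (by omega)
  have h2 : ∀ x y, inner ℝ ((R ^ (2 * (m - (k + 1)))) x) ((R ^ (2 * (m - (k + 1)))) y) =
      inner ℝ ((R ^ (2 * (m - (k + 1)) - 1)) x) ((R ^ (2 * (m - k) - 1)) y) :=
    inner_pow_apply_pow_apply hR (by omega)
  have e := integral_inner_self_eq
    ((R ^ (2 * (m - (k + 1)))).comp_memLp' (h.memLp_of_le hτ him.le))
  simp only [Function.comp_def] at e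
  rw [e, h2] at hp
  simp only [h1] at hp
  have m1 := (R ^ (2 * (m - (k + 1 + 1)))).comp_memLp' (h.memLp_of_le hτ (j := k + 1 + 1) him)
  have m0 := (R ^ (2 * (m - k))).comp_memLp' (h.memLp_of_le hτ (j := k) (by omega))
  have c1 := neg_le_of_abs_le (abs_integral_inner_le m1 m0)
  have hb := real_inner_le_norm ((R ^ (2 * (m - (k + 1)) - 1)) (u (k + 1) τ))
    ((R ^ (2 * (m - k) - 1)) (u k τ))
  have n1 := h.sq_norm_le hτ hR him
  have n2 := h.sq_norm_le hτ hR (show k < m by omega)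
  simp only [Function.comp_def] at c1 hp
  change chainNorm m τ R u (k + 1) ^ 2 ≤ _
  change _ + chainNorm m τ R u (k + 1) ^ 2 = _ at hp
  change - (chainNorm m τ R u (k + 1 + 1) * chainNorm m τ R u k) ≤ _ at c1
  have p0 : 0 ≤ chainNorm m τ R u k := ENNReal.toReal_nonneg
  have p1 : 0 ≤ chainNorm m τ R u (k + 1) := ENNReal.toReal_nonneg
  have p2 : 0 ≤ chainNorm m τ R u (k + 1 + 1) := ENNReal.toReal_nonneg
  set x := chainNorm m τ R u k
  set a := chainNorm m τ R u (k + 1)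
  set y := chainNorm m τ R u (k + 1 + 1)
  set p := ‖(R ^ (2 * (m - (k + 1)) - 1)) (u (k + 1) τ)‖
  set q := ‖(R ^ (2 * (m - k) - 1)) (u k τ)‖
  obtain ⟨s, hs, hs2⟩ : ∃ s, 0 ≤ s ∧ s ^ 2 = x * y := ⟨√(x * y), by positivity, by
    rw [Real.sq_sqrt]; positivity⟩
  have hpq : p * q ≤ 2 * a * s := by
    refine le_of_sq_le_sq ?_ (by positivity)
    calc (p * q) ^ 2 = p ^ 2 * q ^ 2 := by ring
      _ ≤ (2 * (a * y)) * (2 * (x * a)) := by gcongr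
      _ = (2 * a * s) ^ 2 := by rw [mul_pow, hs2]; ring
  -- From `a² ≤ s² + 2 a s` one gets `a ≤ (1 + √2) s`.
  have : a ≤ 3 * s := by nlinarith
  calc a ^ 2 ≤ (3 * s) ^ 2 := by gcongr
    _ = 9 * (x * y) := by rw [mul_pow, hs2]; norm_num

/-- The energy estimate: with a symmetric operator `R`, the quantity
`‖R ^ (2 (m - j) - 1) u_j‖` at the end point is controlled by the `L²` norms of `R ^ (2 m) u_0` and
of `u_m`. -/
theorem IsChain.norm_le {m : ℕ} {τ : ℝ} {u : ℕ → ℝ → H} (hτ : 0 ≤ τ) (h : IsChain m τ u)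
    {R : H →L[ℝ] H} (hR : ∀ x y, inner ℝ (R x) y = inner ℝ x (R y)) {j : ℕ} (hj : j < m) :
    ‖(R ^ (2 * (m - j) - 1)) (u j τ)‖ ≤
      2 * 3 ^ (m ^ 2) * max (eLpNorm (fun s => (R ^ (2 * m)) (u 0 s)) 2
        (volume.restrict (Ioo 0 τ))).toReal (eLpNorm (u m) 2 (volume.restrict (Ioo 0 τ))).toReal := by
  have key : ∀ i ≤ m, chainNorm m τ R u i ≤
      3 ^ (m ^ 2) * max (chainNorm m τ R u 0) (chainNorm m τ R u m) := fun i hi =>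
    le_max_of_sq_le_nine_mul (a := chainNorm m τ R u) (fun _ => ENNReal.toReal_nonneg)
      (fun i h1 h2 => h.sq_chainNorm_le hτ hR h1 h2) hi
  have h0 : chainNorm m τ R u 0 = (eLpNorm (fun s => (R ^ (2 * m)) (u 0 s)) 2
      (volume.restrict (Ioo 0 τ))).toReal := rfl
  have hm : chainNorm m τ R u m = (eLpNorm (u m) 2 (volume.restrict (Ioo 0 τ))).toReal := by
    simp [chainNorm]
  rw [← h0, ← hm]
  have p : ∀ i, 0 ≤ chainNorm m τ R u i := fun i => ENNReal.toReal_nonneg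
  have hM : 0 ≤ max (chainNorm m τ R u 0) (chainNorm m τ R u m) := (p 0).trans (le_max_left _ _)
  generalize max (chainNorm m τ R u 0) (chainNorm m τ R u m) = M at key hM ⊢
  refine le_of_sq_le_sq ?_ (by positivity)
  calc _ ≤ 2 * (chainNorm m τ R u j * chainNorm m τ R u (j + 1)) := h.sq_norm_le hτ hR hj
    _ ≤ 2 * ((3 ^ (m ^ 2) * M) * (3 ^ (m ^ 2) * M)) := by
      have := p (j + 1)
      gcongr
      · exact key j hj.le
      · exact key (j + 1) hj
    _ ≤ (2 * 3 ^ (m ^ 2) * M) ^ 2 := by nlinarith [sq_nonneg ((3 : ℝ) ^ (m ^ 2) * M)]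

end Energy

/-! ### The complex interpolation norm: subadditivity and completeness -/

section Interp

variable {H V : Type*}
  [NormedAddCommGroup H] [NormedSpace ℂ H] [NormedAddCommGroup V] [NormedSpace ℂ V]
  {ι : V →L[ℂ] H} {θ : ℝ}

theorem interpNorm_le {F : ℂ → H} {G : ℝ → V} {C : ℝ} (h : IsCalderonFunction ι F G)
    (h0 : ∀ t : ℝ, ‖F (t * Complex.I)‖ ≤ C) (h1 : ∀ t, ‖G t‖ ≤ C) :
    interpNorm ι θ (F θ) ≤ ENNReal.ofReal C := by
  refine iInf_le_of_le F (iInf_le_of_le G (iInf_le_of_le h (iInf_le_of_le rfl ?_)))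
  refine max_le (iSup_le fun t => ?_) (iSup_le fun t => ?_)
  · rw [← ofReal_norm]; exact ENNReal.ofReal_le_ofReal (h0 t)
  · rw [← ofReal_norm]; exact ENNReal.ofReal_le_ofReal (h1 t)

theorem exists_of_interpNorm_lt {x : H} {C : ℝ} (h : interpNorm ι θ x < ENNReal.ofReal C) :
    ∃ F G, IsCalderonFunction ι F G ∧ F θ = x ∧ (∀ t : ℝ, ‖F (t * Complex.I)‖ ≤ C) ∧
      ∀ t, ‖G t‖ ≤ C := by
  simp only [interpNorm, iInf_lt_iff] at h
  obtain ⟨F, G, hFG, hx, h⟩ := h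
  have hC : 0 ≤ C := by
    by_contra hC
    rw [ENNReal.ofReal_of_nonpos (not_le.1 hC).le] at h
    exact not_lt_bot h
  refine ⟨F, G, hFG, hx, fun t => ?_, fun t => ?_⟩
  · rw [← ENNReal.ofReal_le_ofReal_iff hC, ofReal_norm]
    exact ((le_iSup _ t).trans (le_max_left _ _)).trans h.le
  · rw [← ENNReal.ofReal_le_ofReal_iff hC, ofReal_norm]
    exact ((le_iSup (fun t => ‖G t‖ₑ) t).trans (le_max_right _ _)).trans h.le

theorem IsCalderonFunction.sub {F F' : ℂ → H} {G G' : ℝ → V} (h : IsCalderonFunction ι F G)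
    (h' : IsCalderonFunction ι F' G') :
    IsCalderonFunction ι (fun z => F z - F' z) (fun t => G t - G' t) where
  continuousOn := h.continuousOn.sub h'.continuousOn
  bounded := by
    obtain ⟨C, hC⟩ := h.bounded
    obtain ⟨C', hC'⟩ := h'.bounded
    exact ⟨C + C', fun z h0 h1 => (norm_sub_le _ _).trans (add_le_add (hC z h0 h1) (hC' z h0 h1))⟩
  holomorphic := h.holomorphic.sub h'.holomorphic
  tendsto_left := by simpa using h.tendsto_left.sub h'.tendsto_left
  right_eq t := by rw [h.right_eq, h'.right_eq, map_sub]
  continuous_right := h.continuous_right.sub h'.continuous_right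
  tendsto_right := by simpa using h.tendsto_right.sub h'.tendsto_right

theorem interpNorm_sub_le (x y : H) :
    interpNorm ι θ (x - y) ≤ interpNorm ι θ x + interpNorm ι θ y := by
  by_cases hx : interpNorm ι θ x = ⊤
  · simp [hx]
  by_cases hy : interpNorm ι θ y = ⊤
  · simp [hy]
  refine ENNReal.le_of_forall_pos_le_add fun ε hε _ => ?_
  have key : ∀ z : H, interpNorm ι θ z ≠ ⊤ →
      interpNorm ι θ z < ENNReal.ofReal ((interpNorm ι θ z).toReal + ε / 2) := fun z hz => by
    rw [ENNReal.ofReal_add ENNReal.toReal_nonneg (by positivity), ENNReal.ofReal_toReal hz]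
    exact ENNReal.lt_add_right hz (by simpa using hε)
  obtain ⟨F, G, h1, h2, h3, h4⟩ := exists_of_interpNorm_lt (key x hx)
  obtain ⟨F', G', h1', h2', h3', h4'⟩ := exists_of_interpNorm_lt (key y hy)
  have := interpNorm_le (θ := θ) (h1.sub h1') (fun t => (norm_sub_le _ _).trans
    (add_le_add (h3 t) (h3' t))) (fun t => (norm_sub_le _ _).trans (add_le_add (h4 t) (h4' t)))
  rw [h2, h2'] at this
  refine this.trans (le_of_eq ?_)
  rw [show (interpNorm ι θ x).toReal + ε / 2 + ((interpNorm ι θ y).toReal + ε / 2) =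
    (interpNorm ι θ x).toReal + (interpNorm ι θ y).toReal + ε by ring,
    ENNReal.ofReal_add (by positivity) (by positivity), ENNReal.ofReal_add ENNReal.toReal_nonneg
    ENNReal.toReal_nonneg, ENNReal.ofReal_toReal hx, ENNReal.ofReal_toReal hy,
    ENNReal.ofReal_coe_nnreal]

/-- Three lines theorem for functions in Calderon's space. -/
theorem IsCalderonFunction.norm_le {F : ℂ → H} {G : ℝ → V} (h : IsCalderonFunction ι F G) {C : ℝ}
    (h0 : ∀ t : ℝ, ‖F (t * Complex.I)‖ ≤ C) (h1 : ∀ t, ‖G t‖ ≤ C) {z : ℂ} (hz : 0 ≤ z.re)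
    (hz' : z.re ≤ 1) : ‖F z‖ ≤ max 1 ‖ι‖ * C := by
  have hC : 0 ≤ C := (norm_nonneg _).trans (h1 0)
  obtain ⟨B, hB⟩ := h.bounded
  have hcl : closure (Complex.re ⁻¹' Ioo 0 1) = Complex.re ⁻¹' Icc 0 1 := by
    rw [Complex.closure_preimage_re, closure_Ioo (by norm_num)]
  refine PhragmenLindelof.vertical_strip (a := 0) (b := 1) (f := F) ⟨?_, ?_⟩ ?_ ?_ ?_ hz hz'
  · exact h.holomorphic
  · rw [hcl]; exact h.continuousOn
  · refine ⟨0, by positivity, 0, ?_⟩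
    refine Asymptotics.IsBigO.of_bound B ?_
    refine eventually_inf_principal.2 (Eventually.of_forall fun w hw => ?_)
    simpa using hB w hw.1.le hw.2.le
  · intro w hw
    have : w = w.im * Complex.I := by apply Complex.ext <;> simp [hw]
    rw [this]
    exact (h0 _).trans (le_mul_of_one_le_left hC (le_max_left _ _))
  · intro w hw
    have : w = 1 + w.im * Complex.I := by apply Complex.ext <;> simp [hw]
    rw [this, h.right_eq]
    exact (ι.le_opNorm _).trans (mul_le_mul (le_max_right _ _) (h1 _) (norm_nonneg _)
      (by positivity))

/-- Countable subadditivity of the interpolation norm. -/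
theorem interpNorm_le_tsum [CompleteSpace H] [CompleteSpace V] (hθ : 0 ≤ θ) (hθ' : θ ≤ 1)
    {x : ℕ → H} {y : H} {c : ℕ → ℝ} (hc : Summable c)
    (hx : ∀ n, interpNorm ι θ (x n) < ENNReal.ofReal (c n))
    (hy : Tendsto (fun n => ∑ i ∈ Finset.range n, x i) atTop (𝓝 y)) :
    interpNorm ι θ y ≤ ENNReal.ofReal (∑' n, c n) := by
  choose F G hFG hFx hF hG using fun n => exists_of_interpNorm_lt (hx n)
  -- The interpolation norm sees only the boundary lines; the three lines theorem turns this into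
  -- uniform summability on the whole strip.
  have hb : ∀ n (z : ℂ), 0 ≤ z.re → z.re ≤ 1 → ‖F n z‖ ≤ max 1 ‖ι‖ * c n := fun n z h0 h1 =>
    (hFG n).norm_le (hF n) (hG n) h0 h1
  have hs : Summable fun n => max 1 ‖ι‖ * c n := hc.mul_left _
  have hsum : ∀ z : ℂ, 0 ≤ z.re → z.re ≤ 1 → Summable fun n => F n z := fun z h0 h1 =>
    Summable.of_norm_bounded hs fun n => hb n z h0 h1
  have hsG : ∀ t, Summable fun n => G n t := fun t => Summable.of_norm_bounded hc fun n => hG n t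
  have hFy : ∑' n, F n θ = y := by
    have h1 := (hsum θ (by simpa using hθ) (by simpa using hθ')).hasSum.tendsto_sum_nat
    simp only [hFx] at h1 ⊢
    exact tendsto_nhds_unique h1 hy
  rw [← hFy]
  refine interpNorm_le (F := fun z => ∑' n, F n z) (G := fun t => ∑' n, G n t) ?_ ?_ ?_
  · constructor
    · exact continuousOn_tsum (fun n => (hFG n).continuousOn) hs fun n z hz => hb n z hz.1 hz.2
    · exact ⟨∑' n, max 1 ‖ι‖ * c n, fun z h0 h1 =>
        tsum_of_norm_bounded hs.hasSum fun n => hb n z h0 h1⟩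
    · refine Complex.differentiableOn_tsum_of_summable_norm hs (fun n => (hFG n).holomorphic) ?_
        fun n z hz => hb n z hz.1.le hz.2.le
      exact isOpen_Ioo.preimage Complex.continuous_re
    · have := tendsto_tsum_of_dominated_convergence (𝓕 := cocompact ℝ)
        (f := fun (t : ℝ) n => F n (t * Complex.I)) (g := fun _ => 0) hc
        (fun n => (hFG n).tendsto_left) (Eventually.of_forall fun t n => hF n t)
      simpa using this
    · intro t
      simp only [(hFG _).right_eq]
      exact (ι.map_tsum (hsG t)).symm
    · exact continuous_tsum (fun n => (hFG n).continuous_right) hc hG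
    · have := tendsto_tsum_of_dominated_convergence (𝓕 := cocompact ℝ)
        (f := fun (t : ℝ) n => G n t) (g := fun _ => 0) hc
        (fun n => (hFG n).tendsto_right) (Eventually.of_forall fun t n => hG n t)
      simpa using this
  · exact fun t => tsum_of_norm_bounded hc.hasSum fun n => hF n t
  · exact fun t => tsum_of_norm_bounded hc.hasSum fun n => hG n t

/-- Completeness of the interpolation space, in a quantitative form. -/
theorem interpNorm_sub_le_of_tendsto [CompleteSpace H] [CompleteSpace V] (hθ : 0 ≤ θ) (hθ' : θ ≤ 1)
    {x : ℕ → H} {y : H} {δ : ℕ → ℝ} (hδ0 : ∀ n, 0 ≤ δ n) (hδ : Tendsto δ atTop (𝓝 0))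
    (hx : ∀ n k, interpNorm ι θ (x n - x k) ≤ ENNReal.ofReal (δ n + δ k))
    (hy : Tendsto x atTop (𝓝 y)) (n : ℕ) {η : ℝ} (hη : 0 < η) :
    interpNorm ι θ (x n - y) ≤ ENNReal.ofReal (δ n + η) := by
  have hex : ∀ i : ℕ, ∃ k, i ≤ k ∧ δ k < η / 8 * (1 / 2) ^ i := fun i =>
    ((eventually_ge_atTop i).and (hδ.eventually_lt_const (by positivity))).exists
  choose k hk1 hk2 using hex
  -- The difference `x n - y` is telescoped along a fast subsequence that starts at `n` itself. Only
  -- the first increment then costs `δ n`, and the remaining costs fit into a geometric series of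
  -- sum `η`.
  let κ : ℕ → ℕ := fun i => Nat.casesOn i n k
  have hκ : Tendsto κ atTop atTop := by
    rw [← tendsto_add_atTop_iff_nat 1]
    exact tendsto_atTop_mono hk1 tendsto_id
  let c : ℕ → ℝ := fun i => (if i = 0 then δ n else 0) + η / 2 * (1 / 2) ^ i
  have hg : HasSum (fun i : ℕ => η / 2 * (1 / 2 : ℝ) ^ i) η := by
    have := (hasSum_geometric_two).mul_left (η / 2)
    simpa using this
  have hc : HasSum c (δ n + η) := by
    refine HasSum.add ?_ hg
    convert hasSum_ite_eq (0 : ℕ) (δ n) using 1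
  have h1 := interpNorm_le_tsum (ι := ι) hθ hθ' (x := fun i => x (κ i) - x (κ (i + 1)))
    (y := x n - y) hc.summable (fun i => ?_) ?_
  · rwa [hc.tsum_eq] at h1
  · refine (hx _ _).trans_lt ?_
    cases i with
    | zero =>
      have := hk2 0
      refine (ENNReal.ofReal_lt_ofReal_iff ?_).2 ?_
      · have := hδ0 n; simp only [c]; positivity
      · simp only [c, κ]; simp at this ⊢; linarith
    | succ i =>
      have h3 := hk2 i
      have h4 := hk2 (i + 1)
      have hq : 0 < η * (1 / 2 : ℝ) ^ i := by positivity
      have hci : c (i + 1) = η / 2 * (1 / 2) ^ (i + 1) := by simp [c]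
      refine (ENNReal.ofReal_lt_ofReal_iff (by rw [hci]; positivity)).2 ?_
      change δ (k i) + δ (k (i + 1)) < c (i + 1)
      rw [hci]
      rw [pow_succ] at h4 ⊢
      linarith
  · have h2 : ∀ N, ∑ i ∈ Finset.range N, (x (κ i) - x (κ (i + 1))) = x n - x (κ N) := fun N =>
      Finset.sum_range_sub' (fun i => x (κ i)) N
    simp only [h2]
    exact (hy.comp hκ).const_sub _

end Interp

/-! ### Complex powers of `S + ε` as exponentials -/

section OpExp

variable {H : Type*} [NormedAddCommGroup H] [InnerProductSpace ℂ H] [CompleteSpace H]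

/-- The operators `exp (w L)`. -/
noncomputable def opExp (L : H →L[ℂ] H) (w : ℂ) : H →L[ℂ] H := NormedSpace.exp (w • L)

theorem opExp_add (L : H →L[ℂ] H) (w z : ℂ) : opExp L (w + z) = opExp L w * opExp L z := by
  let +nondep : NormedAlgebra ℚ (H →L[ℂ] H) := .restrictScalars ℚ ℂ _
  rw [opExp, add_smul]
  exact NormedSpace.exp_add_of_commute (((Commute.refl L).smul_left w).smul_right z)

theorem opExp_zero (L : H →L[ℂ] H) : opExp L 0 = 1 := by simp [opExp]

theorem opExp_pow (L : H →L[ℂ] H) (w : ℂ) (n : ℕ) : opExp L w ^ n = opExp L (n * w) := by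
  induction n with
  | zero => simp [opExp_zero]
  | succ n ih => rw [pow_succ, ih, ← opExp_add]; congr 1; push_cast; ring

theorem opExp_differentiable (L : H →L[ℂ] H) : Differentiable ℂ (opExp L) := fun w =>
  (hasDerivAt_exp_smul_const L w).differentiableAt

theorem commute_opExp {S L : H →L[ℂ] H} (h : Commute S L) (w : ℂ) : Commute S (opExp L w) :=
  (h.smul_right w).exp_right

theorem norm_opExp_mul_I {L : H →L[ℂ] H} (hL : IsSelfAdjoint L) (t : ℝ) (x : H) :
    ‖opExp L (t * Complex.I) x‖ = ‖x‖ := by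
  refine ContinuousLinearMap.norm_map_of_mem_unitary ?_ x
  have := (selfAdjoint.expUnitary (⟨(t : ℂ) • L, ?_⟩ : selfAdjoint (H →L[ℂ] H))).2
  · rw [selfAdjoint.expUnitary_coe] at this
    rw [opExp, mul_comm, mul_smul]
    exact this
  · rw [selfAdjoint.mem_iff, star_smul, hL.star_eq]; simp

theorem isSelfAdjoint_opExp {L : H →L[ℂ] H} (hL : IsSelfAdjoint L) (r : ℝ) :
    IsSelfAdjoint (opExp L r) := by
  rw [IsSelfAdjoint, opExp, NormedSpace.star_exp, star_smul, hL.star_eq]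
  simp

/-- The imaginary part of `w` contributes a unitary factor, and the real part runs over a compact
interval. -/
theorem exists_norm_opExp_le {L : H →L[ℂ] H} (hL : IsSelfAdjoint L) (a b : ℝ) :
    ∃ C, ∀ w : ℂ, a ≤ w.re → w.re ≤ b → ∀ x, ‖opExp L w x‖ ≤ C * ‖x‖ := by
  obtain ⟨C, hC⟩ := (isCompact_Icc (a := a) (b := b)).exists_bound_of_continuousOn
    (f := fun r : ℝ => opExp L r)
    ((opExp_differentiable L).continuous.comp Complex.continuous_ofReal).continuousOn
  refine ⟨C, fun w h1 h2 x => ?_⟩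
  have : w = w.im * Complex.I + w.re := by apply Complex.ext <;> simp
  rw [this, opExp_add, mul_apply_eq_comp, norm_opExp_mul_I hL]
  exact ((opExp L w.re).le_opNorm x).trans (by gcongr; exact hC _ ⟨h1, h2⟩)

/-- Adding `ε` makes the spectrum strictly positive, so the logarithm is a bounded operator. The
commutation clause makes the regularizations for different `ε` commute with each other. -/
theorem exists_log {S : H →L[ℂ] H} (hS : 0 ≤ S) {ε : ℝ} (hε : 0 < ε) :
    ∃ L : H →L[ℂ] H, IsSelfAdjoint L ∧ opExp L 1 = S + algebraMap ℝ _ ε ∧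
      ∀ B, Commute S B → Commute L B := by
  refine ⟨CFC.log (S + algebraMap ℝ _ ε), IsSelfAdjoint.log, ?_, ?_⟩
  · rw [opExp, one_smul]
    exact CFC.exp_log _
  · exact fun B hB => Commute.cfc_real (Commute.add_left hB (Algebra.commutes ε B)) _

/-- The contraction `S (S + ε)⁻¹`, where `exp L = S + ε`. -/
theorem norm_mul_opExp_neg_one_le {S L : H →L[ℂ] H} (hS : 0 ≤ S) {ε : ℝ} (hε : 0 < ε)
    (h1 : opExp L 1 = S + algebraMap ℝ _ ε) (x : H) : ‖(S * opExp L (-1)) x‖ ≤ ‖x‖ := by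
  set y := opExp L (-1) x
  have hx : x = S y + (ε : ℂ) • y := by
    have h2 : (opExp L 1 * opExp L (-1)) x = x := by rw [← opExp_add]; simp [opExp_zero]
    rw [h1] at h2
    rw [← h2, add_mul, add_apply]
    congr 1
  have hpos := ((ContinuousLinearMap.nonneg_iff_isPositive S).1 hS).re_inner_nonneg_left y
  change ‖S y‖ ≤ _
  conv_rhs => rw [hx]
  -- With `y = (S + ε)⁻¹ x`, expanding `‖S y + ε y‖²` gives `‖S y‖²` plus terms that are nonnegative
  -- because `S ≥ 0`.
  refine le_of_sq_le_sq ?_ (norm_nonneg _)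
  rw [@norm_add_sq ℂ, inner_smul_right]
  simp only [RCLike.re_to_complex, Complex.re_ofReal_mul] at hpos ⊢
  have := mul_nonneg hε.le hpos
  nlinarith [sq_nonneg ‖(ε : ℂ) • y‖]

/-- Follows from `S (S + ε)⁻¹ S - S = -ε S (S + ε)⁻¹`. It gives convergence to the identity, with a
rate, on the range of `S`. -/
theorem norm_mul_opExp_neg_one_sub_le {S L : H →L[ℂ] H} (hS : 0 ≤ S) {ε : ℝ} (hε : 0 < ε)
    (h1 : opExp L 1 = S + algebraMap ℝ _ ε) (y : H) :
    ‖(S * opExp L (-1)) (S y) - S y‖ ≤ ε * ‖y‖ := by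
  have h2 : opExp L (-1) * opExp L 1 = 1 := by rw [← opExp_add]; simp [opExp_zero]
  have h3 : (S * opExp L (-1)) (S y) - S y = - ((ε : ℂ) • (S * opExp L (-1)) y) := by
    have h4 : S * opExp L (-1) * S - S = - ((ε : ℂ) • (S * opExp L (-1))) := by
      have h5 : S * opExp L (-1) * S + (ε : ℂ) • (S * opExp L (-1)) = S := by
        calc _ = S * (opExp L (-1) * (S + algebraMap ℝ _ ε)) := by
              rw [mul_add, mul_add, mul_assoc, ← Algebra.commutes ε, ← Algebra.smul_def]
              congr 1
              rw [mul_smul_comm]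
              ext x; simp
          _ = S := by rw [← h1, h2, mul_one]
      rw [eq_neg_iff_add_eq_zero, sub_add_eq_add_sub, h5, sub_self]
    exact congrArg (fun T : H →L[ℂ] H => T y) h4
  rw [h3, norm_neg, norm_smul]
  simp only [Complex.norm_real, Real.norm_eq_abs, abs_of_pos hε]
  gcongr
  exact norm_mul_opExp_neg_one_le hS hε h1 y

end OpExp

/-! ### Polar decomposition of the embedding -/

section Factor

variable {H V : Type*} [NormedAddCommGroup H] [InnerProductSpace ℂ H] [CompleteSpace H]
  [NormedAddCommGroup V] [InnerProductSpace ℂ V] [CompleteSpace V]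

/-- The embedding `ι` is the `m`-th power of a positive operator on `H`, up to contractions between
`V` and `H`. -/
theorem exists_positive_root {ι : V →L[ℂ] H} (hι : DenseRange ι) {m : ℕ} (hm : 1 ≤ m) :
    ∃ (S : H →L[ℂ] H) (W : H →L[ℂ] V) (U : V →L[ℂ] H), 0 ≤ S ∧ DenseRange S ∧ (∀ x, ‖W x‖ ≤ ‖x‖) ∧
      (∀ v, ‖U v‖ ≤ ‖v‖) ∧ (∀ x, ι (W x) = (S ^ m) x) ∧ ∀ v, (S ^ m) (U v) = ι v := by
  set T : H →L[ℂ] H := ι ∘L ContinuousLinearMap.adjoint ι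
  have hT : 0 ≤ T := (ContinuousLinearMap.nonneg_iff_isPositive _).2
    (ContinuousLinearMap.isPositive_self_comp_adjoint ι)
  set S : H →L[ℂ] H := T ^ (1 / (2 * m : ℝ))
  have hm' : (0 : ℝ) < m := by exact_mod_cast hm
  have hS : 0 ≤ S := CFC.rpow_nonneg
  have hSa : IsSelfAdjoint S := hS.isSelfAdjoint
  have hST : S ^ (2 * m) = T := by
    rw [← CFC.rpow_natCast S (2 * m) hS,
      CFC.rpow_rpow_of_exponent_nonneg T _ _ (by positivity) (by positivity) hT]
    have : 1 / (2 * (m : ℝ)) * ((2 * m : ℕ) : ℝ) = 1 := by push_cast; field_simp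
    rw [this, CFC.rpow_one T hT]
  have hSma : ContinuousLinearMap.adjoint (S ^ m) = S ^ m := (hSa.pow m).star_eq
  have hn : ∀ x, ‖ContinuousLinearMap.adjoint ι x‖ = ‖(S ^ m) x‖ := fun x => by
    refine (sq_eq_sq₀ (norm_nonneg _) (norm_nonneg _)).1 ?_
    have h1 : inner ℂ ((S ^ m) x) ((S ^ m) x) = inner ℂ (ContinuousLinearMap.adjoint ι x)
        (ContinuousLinearMap.adjoint ι x) := by
      rw [ContinuousLinearMap.adjoint_inner_right]
      nth_rewrite 2 [← hSma]
      rw [ContinuousLinearMap.adjoint_inner_right, ← mul_apply_eq_comp, ← pow_add, ← two_mul, hST]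
      rfl
    rw [← @inner_self_eq_norm_sq ℂ, ← @inner_self_eq_norm_sq ℂ, h1]
  have hinj : ∀ x, ContinuousLinearMap.adjoint ι x = 0 → x = 0 := fun x hx => by
    refine hι.eq_zero_of_inner_left (𝕜 := ℂ) fun v => ?_
    rw [← ContinuousLinearMap.adjoint_inner_left, hx, inner_zero_left]
  -- The kernel of `S` lies in that of `ι*`, which is trivial because `ι` has dense range.
  have hSd : DenseRange S := by
    have h1 : S.toLinearMap.rangeᗮ = ⊥ := by
      rw [ContinuousLinearMap.orthogonal_range, hSa.adjoint_eq, LinearMap.ker_eq_bot']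
      intro x hx
      refine hinj x (norm_eq_zero.1 ?_)
      obtain ⟨k, rfl⟩ := Nat.exists_eq_add_of_le' hm
      have hx' : S x = 0 := hx
      rw [hn, pow_succ, mul_apply_eq_comp, hx', map_zero, norm_zero]
    have h2 := Submodule.topologicalClosure_eq_top_iff.2 h1
    rw [← Submodule.dense_iff_topologicalClosure_eq_top] at h2
    exact h2
  have hSmd : DenseRange (S ^ m : H →L[ℂ] H) := by
    clear_value S
    clear hm hm' hST hSma hn hinj
    induction m with
    | zero => simpa using! Function.surjective_id.denseRange
    | succ m ih =>
      rw [pow_succ']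
      exact hSd.comp ih S.continuous
  -- As `‖ι* x‖ = ‖S ^ m x‖`, the map `S ^ m x ↦ ι* x` is well defined and isometric on a dense
  -- subspace, and `W` is its extension. Taking adjoints in `W S ^ m = ι*` gives `S ^ m W* = ι`, so
  -- `U = W*`.
  set W : H →L[ℂ] V := (ContinuousLinearMap.adjoint ι).toLinearMap.extendOfNorm (S ^ m).toLinearMap
  have hWS : ∀ x, W ((S ^ m) x) = ContinuousLinearMap.adjoint ι x := fun x =>
    LinearMap.extendOfNorm_eq hSmd ⟨1, fun x => (hn x).le.trans_eq (one_mul _).symm⟩ x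
  have hW : ∀ x, ‖W x‖ ≤ 1 * ‖x‖ := LinearMap.norm_extendOfNorm_apply_le hSmd 1
    fun x => (hn x).le.trans_eq (one_mul _).symm
  have hιW : ∀ x, ι (W x) = (S ^ m) x := fun x => by
    refine hSmd.induction_on (p := fun x => ι (W x) = (S ^ m) x) x
      (isClosed_eq (by fun_prop) (by fun_prop)) fun y => ?_
    rw [hWS, ← mul_apply_eq_comp, ← pow_add, ← two_mul, hST]
    rfl
  refine ⟨S, W, ContinuousLinearMap.adjoint W, hS, hSd, by simpa using hW, fun v => ?_, hιW,
    fun v => ?_⟩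
  · refine ((ContinuousLinearMap.adjoint W).le_opNorm v).trans ?_
    rw [LinearIsometryEquiv.norm_map]
    exact mul_le_of_le_one_left (norm_nonneg _) (W.opNorm_le_bound zero_le_one hW)
  · refine ext_inner_right ℂ fun x => ?_
    rw [← hSma, ContinuousLinearMap.adjoint_inner_left, ContinuousLinearMap.adjoint_inner_left, hWS,
      ContinuousLinearMap.adjoint_inner_right]

end Factor

/-! ### Strong convergence of operators -/

theorem tendsto_eLpNorm_apply_zero {α E : Type*} [MeasurableSpace α] {μ : Measure α}
    [NormedAddCommGroup E] [NormedSpace ℝ E] {h : α → E} (hh : MemLp h 2 μ) {T : ℕ → E →L[ℝ] E}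
    (hT : ∀ n x, ‖T n x‖ ≤ 2 * ‖x‖) (hT0 : ∀ x, Tendsto (fun n => T n x) atTop (𝓝 0)) :
    Tendsto (fun n => eLpNorm (fun s => T n (h s)) 2 μ) atTop (𝓝 0) := by
  simp only [eLpNorm_eq_lintegral_rpow_enorm_toReal two_ne_zero ENNReal.ofNat_ne_top]
  have key : Tendsto (fun n => ∫⁻ s, ‖T n (h s)‖ₑ ^ (2 : ℝ) ∂μ) atTop (𝓝 (∫⁻ _, 0 ∂μ)) := by
    refine tendsto_lintegral_of_dominated_convergence' (fun s => (2 * ‖h s‖ₑ) ^ (2 : ℝ)) ?_ ?_ ?_ ?_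
    · intro n
      exact (((T n).continuous.comp_aestronglyMeasurable hh.1).enorm).pow_const _
    · intro n
      refine Eventually.of_forall fun s => ?_
      simp only
      gcongr
      have := ENNReal.ofReal_le_ofReal (hT n (h s))
      rwa [ENNReal.ofReal_mul zero_le_two, ofReal_norm, ofReal_norm, ENNReal.ofReal_ofNat] at this
    · simp only [ENNReal.mul_rpow_of_nonneg _ _ zero_le_two]
      rw [lintegral_const_mul' _ _ (by norm_num)]
      refine ENNReal.mul_ne_top (by norm_num) ?_
      have := lintegral_rpow_enorm_lt_top_of_eLpNorm_lt_top two_ne_zero ENNReal.ofNat_ne_top hh.2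
      simpa using this.ne
    · refine Eventually.of_forall fun s => ?_
      have h1 : Tendsto (fun n => ‖T n (h s)‖ₑ) atTop (𝓝 0) := by
        simpa using (hT0 (h s)).enorm
      have h2 := h1.ennrpow_const (2 : ℝ)
      simpa using h2
  have h2 := key.ennrpow_const (1 / 2 : ℝ)
  simpa using h2

theorem tendsto_pow_apply {𝕜 E : Type*} [NontriviallyNormedField 𝕜] [NormedAddCommGroup E]
    [NormedSpace 𝕜 E] {T : ℕ → E →L[𝕜] E} (hT : ∀ n x, ‖T n x‖ ≤ ‖x‖)
    (hT1 : ∀ x, Tendsto (fun n => T n x) atTop (𝓝 x)) (m : ℕ) (x : E) :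
    Tendsto (fun n => (T n ^ m) x) atTop (𝓝 x) := by
  induction m with
  | zero => simp
  | succ m ih =>
    have h1 : ∀ n, (T n ^ (m + 1)) x = T n ((T n ^ m) x - x) + T n x := fun n => by
      rw [map_sub, sub_add_cancel, pow_succ']; rfl
    simp only [h1]
    have h2 : Tendsto (fun n => T n ((T n ^ m) x - x)) atTop (𝓝 0) :=
      squeeze_zero_norm (fun n => hT n _) (by simpa using (ih.sub_const x).norm)
    simpa using h2.add (hT1 x)

theorem norm_pow_apply_le {𝕜 E : Type*} [NontriviallyNormedField 𝕜] [NormedAddCommGroup E]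
    [NormedSpace 𝕜 E] {T : E →L[𝕜] E} (hT : ∀ x, ‖T x‖ ≤ ‖x‖) (m : ℕ) (x : E) :
    ‖(T ^ m) x‖ ≤ ‖x‖ := by
  induction m with
  | zero => simp
  | succ m ih => rw [pow_succ']; exact (hT _).trans ih

/-! ### An explicit Calderon function -/

section Calderon

variable {H V : Type*} [NormedAddCommGroup H] [InnerProductSpace ℂ H] [CompleteSpace H]
  [NormedAddCommGroup V] [NormedSpace ℂ V]

theorem norm_cexp_sq_sub (z : ℂ) (θ : ℝ) :
    ‖Complex.exp ((z - θ) ^ 2)‖ = Real.exp ((z.re - θ) ^ 2 - z.im ^ 2) := by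
  rw [Complex.norm_exp]
  congr 1
  simp [sq]

theorem tendsto_exp_neg_sq : Tendsto (fun t : ℝ => Real.exp 1 * Real.exp (-t ^ 2)) (cocompact ℝ)
    (𝓝 0) := by
  have h1 : Tendsto (fun t : ℝ => -t ^ 2) (cocompact ℝ) atBot := by
    have h2 : Tendsto (fun t : ℝ => ‖t‖ ^ 2) (cocompact ℝ) atTop :=
      (tendsto_pow_atTop two_ne_zero).comp tendsto_norm_cocompact_atTop
    simp only [Real.norm_eq_abs, sq_abs] at h2
    exact tendsto_neg_atTop_atBot.comp h2
  simpa using (Real.tendsto_exp_atBot.comp h1).const_mul (Real.exp 1)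

/-- The competitor is `S ^ m (S + ε) ^ ((z - θ - 1) m) x` times a Gaussian, where `S + ε` stands for
`exp L`. On both boundary lines, imaginary powers are unitary and what remains is `(S + ε) ^ (-θ m)
x`: on the left behind the contraction `J`, on the right behind `ι W = S ^ m`, where `W` is a
contraction into `V`. -/
theorem interpNorm_regularized_le {ι : V →L[ℂ] H} {S L : H →L[ℂ] H} {W : H →L[ℂ] V} {m : ℕ}
    (hL : IsSelfAdjoint L) (hSL : Commute S L) (hW : ∀ x, ‖W x‖ ≤ ‖x‖)
    (hιW : ∀ x, ι (W x) = (S ^ m) x) (hJ : ∀ x, ‖(S ^ m * opExp L (-m)) x‖ ≤ ‖x‖) {θ : ℝ}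
    (hθ : 0 ≤ θ) (hθ' : θ ≤ 1) (x : H) :
    interpNorm ι θ ((S ^ m * opExp L (-m)) x) ≤
      ENNReal.ofReal (Real.exp 1 * ‖opExp L (-(θ * m)) x‖) := by
  have hsq : ∀ r : ℝ, 0 ≤ r → r ≤ 1 → ∀ b : ℝ, Real.exp ((r - θ) ^ 2 - b ^ 2) ≤
      Real.exp 1 * Real.exp (- b ^ 2) := fun r h0 h1 b => by
    rw [← Real.exp_add]
    refine Real.exp_le_exp.2 ?_
    nlinarith
  have hsq' : ∀ b : ℝ, Real.exp 1 * Real.exp (- b ^ 2) ≤ Real.exp 1 := fun b =>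
    mul_le_of_le_one_right (Real.exp_pos _).le (Real.exp_le_one_iff.2 (by nlinarith))
  -- The Gaussian factor equals `1` at `θ`, forces decay at infinity, and costs at most `exp 1`
  -- since `|Re z - θ| ≤ 1` on the strip.
  set F : ℂ → H := fun z => Complex.exp ((z - θ) ^ 2) • (S ^ m) (opExp L ((z - θ - 1) * m) x)
  set G : ℝ → V := fun t => Complex.exp (((1 + t * Complex.I : ℂ) - θ) ^ 2) •
    W (opExp L ((m * t : ℝ) * Complex.I) (opExp L (-(θ * m)) x))
  have hFθ : F θ = (S ^ m * opExp L (-m)) x := by simp [F]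
  have hFd : Differentiable ℂ F := by
    refine Differentiable.smul (by fun_prop) ((S ^ m).differentiable.comp ?_)
    exact ((opExp_differentiable L).comp (by fun_prop)).clm_apply (differentiable_const x)
  have hF0 : ∀ t : ℝ, ‖F (t * Complex.I)‖ ≤
      Real.exp 1 * Real.exp (-t ^ 2) * ‖opExp L (-(θ * m)) x‖ := fun t => by
    have h1 : (S ^ m) (opExp L ((t * Complex.I - θ - 1) * m) x) = opExp L ((m * t : ℝ) * Complex.I)
        ((S ^ m * opExp L (-m)) (opExp L (-(θ * m)) x)) := by
      have e : ((t * Complex.I - θ - 1) * m : ℂ) =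
        (m * t : ℝ) * Complex.I + (-m + -(θ * m)) := by push_cast; ring
      have hc := (commute_opExp (hSL.pow_left m) ((m * t : ℝ) * Complex.I)).eq
      rw [e, opExp_add, opExp_add]
      have := congrArg (fun T : H →L[ℂ] H => T (opExp L (-m) (opExp L (-(θ * m)) x))) hc
      exact this
    simp only [F, norm_smul, h1, norm_opExp_mul_I hL, norm_cexp_sq_sub]
    gcongr
    · simpa using hsq 0 le_rfl zero_le_one t
    · exact hJ _
  have hG : ∀ t : ℝ, ‖G t‖ ≤ Real.exp 1 * Real.exp (-t ^ 2) * ‖opExp L (-(θ * m)) x‖ := fun t => by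
    simp only [G, norm_smul, norm_cexp_sq_sub]
    gcongr
    · simpa using hsq 1 zero_le_one le_rfl t
    · exact (hW _).trans (norm_opExp_mul_I hL _ _).le
  rw [← hFθ]
  refine interpNorm_le (G := G) ⟨hFd.continuous.continuousOn, ?_, hFd.differentiableOn, ?_, ?_, ?_,
    ?_⟩ ?_ ?_
  · obtain ⟨C, hC⟩ := exists_norm_opExp_le hL ((-θ - 1) * m) ((1 - θ - 1) * m)
    refine ⟨Real.exp 1 * (‖S ^ m‖ * (C * ‖x‖)), fun z h0 h1 => ?_⟩
    simp only [F, norm_smul, norm_cexp_sq_sub]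
    refine mul_le_mul ((hsq _ h0 h1 _).trans (hsq' _)) ?_ (norm_nonneg _) (Real.exp_pos _).le
    · refine ((S ^ m).le_opNorm _).trans ?_
      gcongr
      refine hC _ ?_ ?_ x
      · simp; gcongr; linarith
      · simp only [Complex.mul_re, Complex.sub_re, Complex.ofReal_re, Complex.one_re,
          Complex.natCast_re, Complex.natCast_im, mul_zero, sub_zero]
        gcongr
  · exact squeeze_zero_norm hF0 (by simpa using tendsto_exp_neg_sq.mul_const _)
  · intro t
    have h1 : (S ^ m) (opExp L ((1 + t * Complex.I - θ - 1) * m) x) =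
        ι (W (opExp L ((m * t : ℝ) * Complex.I) (opExp L (-(θ * m)) x))) := by
      have e : ((1 + t * Complex.I - θ - 1) * m : ℂ) =
        (m * t : ℝ) * Complex.I + -(θ * m) := by push_cast; ring
      rw [hιW, e, opExp_add]
      rfl
    simp only [F, G, map_smul, h1]
  · refine Continuous.smul (by fun_prop) (W.continuous.comp ?_)
    exact ((opExp_differentiable L).continuous.comp (by fun_prop)).clm_apply continuous_const
  · exact squeeze_zero_norm hG (by simpa using tendsto_exp_neg_sq.mul_const _)
  · exact fun t => (hF0 t).trans (by gcongr; exact hsq' t)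
  · exact fun t => (hG t).trans (by gcongr; exact hsq' t)

end Calderon

/-! ### The trace estimate for chains -/

section Core

variable {H V : Type*} [NormedAddCommGroup H] [InnerProductSpace ℂ H]

theorem tendsto_apply_of_denseRange {S : H →L[ℂ] H} (hS : DenseRange S) {T : ℕ → H →L[ℂ] H}
    (hT : ∀ n x, ‖T n x‖ ≤ ‖x‖) {ε : ℕ → ℝ} (hε : Tendsto ε atTop (𝓝 0))
    (hTS : ∀ n y, ‖T n (S y) - S y‖ ≤ ε n * ‖y‖) (x : H) :
    Tendsto (fun n => T n x) atTop (𝓝 x) := by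
  rw [Metric.tendsto_atTop']
  intro r hr
  obtain ⟨y, hy⟩ := hS.exists_dist_lt x (show 0 < r / 3 by positivity)
  rw [dist_eq_norm] at hy
  have h1 : Tendsto (fun n => ε n * ‖y‖) atTop (𝓝 0) := by simpa using hε.mul_const ‖y‖
  obtain ⟨N, hN⟩ := eventually_atTop.1 (h1.eventually_lt_const (show 0 < r / 3 by positivity))
  refine ⟨N, fun n hn => ?_⟩
  have h2 : T n x - x = T n (x - S y) + (T n (S y) - S y) - (x - S y) := by rw [map_sub]; abel
  rw [dist_eq_norm, h2]
  have h3 := hT n (x - S y)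
  have h4 := hTS n y
  have h5 := hN n hn.le
  have h6 := norm_sub_le (T n (x - S y) + (T n (S y) - S y)) (x - S y)
  have h7 := norm_add_le (T n (x - S y)) (T n (S y) - S y)
  linarith

variable [CompleteSpace H] [NormedAddCommGroup V] [InnerProductSpace ℂ V]

theorem IsChain.interpNorm_regularized_le {ι : V →L[ℂ] H} {S L : H →L[ℂ] H} {W : H →L[ℂ] V}
    {m : ℕ} (hm : 1 ≤ m)
    (hL : IsSelfAdjoint L) (hSL : Commute S L) (hW : ∀ x, ‖W x‖ ≤ ‖x‖)
    (hιW : ∀ x, ι (W x) = (S ^ m) x) (hJ : ∀ x, ‖(S ^ m * opExp L (-m)) x‖ ≤ ‖x‖) {t : ℝ}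
    (ht : 0 ≤ t) {v : ℕ → ℝ → H} (hv : IsChain m t v) {h : ℝ → H}
    (hh : MemLp h 2 (volume.restrict (Ioo 0 t)))
    (hvh : v 0 =ᵐ[volume.restrict (Ioo 0 t)] fun s => (S ^ m) (h s)) {j : ℕ} (hj : j < m) :
    interpNorm ι (1 - (2 * j + 1) / (2 * m)) ((S ^ m * opExp L (-m)) (v j t)) ≤
      ENNReal.ofReal (Real.exp 1 * (2 * 3 ^ (m ^ 2) *
        max (eLpNorm h 2 (volume.restrict (Ioo 0 t))).toReal
          (eLpNorm (v m) 2 (volume.restrict (Ioo 0 t))).toReal)) := by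
  have hm0 : (0 : ℝ) < m := by exact_mod_cast hm
  have hjm : (j : ℝ) + 1 ≤ m := by exact_mod_cast hj
  have hθ : (0 : ℝ) ≤ 1 - (2 * j + 1) / (2 * m) := by
    rw [sub_nonneg, div_le_one (by positivity)]; linarith
  have hθ' : (1 : ℝ) - (2 * j + 1) / (2 * m) ≤ 1 := by
    rw [sub_le_self_iff]; positivity
  refine (TimeTrace.interpNorm_regularized_le hL hSL hW hιW hJ hθ hθ' _).trans ?_
  refine ENNReal.ofReal_le_ofReal (mul_le_mul_of_nonneg_left ?_ (Real.exp_pos 1).le)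
  let : InnerProductSpace ℝ H := InnerProductSpace.complexToReal
  -- The square root `(S + ε)^(-1/2)` is used because the exponent `θ m = m - j - 1/2` is a
  -- half-integer; the energy estimate then involves only natural powers of `R`.
  set Q : H →L[ℂ] H := opExp L ((-(1 / 2) : ℝ) : ℂ)
  have hQ := isSelfAdjoint_opExp hL (-(1 / 2))
  set R : H →L[ℝ] H := Q.restrictScalars ℝ
  have hR : ∀ x y, inner ℝ (R x) y = inner ℝ x (R y) := fun x y => by
    rw [real_inner_eq_re_inner ℂ, real_inner_eq_re_inner ℂ]
    exact congrArg _ (hQ.isSymmetric x y)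
  have hpow : ∀ (n : ℕ) x, (R ^ n) x = opExp L (-(n / 2 : ℝ) : ℝ) x := fun n x => by
    have h1 : (R ^ n) x = (Q ^ n) x := by
      induction n with
      | zero => simp
      | succ n ih => rw [pow_succ', pow_succ', mul_apply_eq_comp, ih]; rfl
    rw [h1, opExp_pow]
    congr 2
    push_cast; ring
  have key := hv.norm_le ht hR hj
  have e1 : (((2 * (m - j) - 1 : ℕ) : ℝ)) = 2 * (m - j) - 1 := by
    rw [Nat.cast_sub (by omega), Nat.cast_mul, Nat.cast_sub hj.le]; simp
  have e2 : (-(((1 - (2 * j + 1) / (2 * m) : ℝ) : ℂ) * m)) =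
      ((-(((2 * (m - j) - 1 : ℕ) : ℝ) / 2) : ℝ) : ℂ) := by
    rw [e1, ← Complex.ofReal_natCast, ← Complex.ofReal_mul, ← Complex.ofReal_neg]
    congr 1
    field_simp
    ring
  rw [e2, ← hpow]
  refine key.trans ?_
  gcongr
  · exact hh.2.ne
  -- Here `R ^ (2 m) v_0 = (S + ε)⁻ᵐ S ^ m h = J h`, and `J` is a contraction, so the bound does not
  -- involve `ε`.
  · refine (eLpNorm_congr_ae (g := fun s => (S ^ m * opExp L (-m)) (h s)) ?_).trans_le ?_
    · filter_upwards [hvh] with s hs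
      rw [hs, hpow]
      have : ((-(((2 * m : ℕ) : ℝ) / 2) : ℝ) : ℂ) = -m := by push_cast; ring
      rw [this, ((commute_opExp (hSL.pow_left m) (-m)).eq)]
      rfl
    · exact eLpNorm_mono fun s => hJ _

/-- The trace estimate for chains, in terms of the complex interpolation norm. -/
theorem exists_interpNorm_le [CompleteSpace V] {ι : V →L[ℂ] H} (hι : DenseRange ι) {m : ℕ} (hm : 1 ≤ m) :
    ∃ k : ℝ, 0 < k ∧ ∀ τ : ℝ, 0 < τ → ∀ (f : ℝ → V) (u : ℕ → ℝ → H),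
      MemLp f 2 (volume.restrict (Ioo 0 τ)) → IsChain m τ u →
      (u 0 =ᵐ[volume.restrict (Ioo 0 τ)] fun t => ι (f t)) → ∀ j < m,
      ContinuousInto (interpNorm ι (1 - (2 * j + 1) / (2 * m))) τ (u j) ∧
      ∀ t ∈ Icc 0 τ, interpNorm ι (1 - (2 * j + 1) / (2 * m)) (u j t) ≤ ENNReal.ofReal k *
        max (eLpNorm f 2 (volume.restrict (Ioo 0 τ)))
          (eLpNorm (u m) 2 (volume.restrict (Ioo 0 τ))) := by
  obtain ⟨S, W, U, hS, hSd, hW, hU, hιW, hSU⟩ := exists_positive_root hι hm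
  choose L hL hL1 hLc using fun n : ℕ => exists_log hS (ε := 1 / ((n : ℝ) + 1)) (by positivity)
  have hSL : ∀ n, Commute S (L n) := fun n => (hLc n S (Commute.refl S)).symm
  have hLL : ∀ n k, Commute (L n) (L k) := fun n k => hLc n _ (hSL k)
  set J : ℕ → H →L[ℂ] H := fun n => S ^ m * opExp (L n) (-m)
  have hJpow : ∀ n, J n = (S * opExp (L n) (-1)) ^ m := fun n => by
    rw [(commute_opExp (hSL n) (-1)).mul_pow, opExp_pow, mul_neg_one]
  have hJ : ∀ n x, ‖J n x‖ ≤ ‖x‖ := fun n x => by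
    rw [hJpow]
    exact norm_pow_apply_le (norm_mul_opExp_neg_one_le hS (by positivity) (hL1 n)) m x
  have hJ1 : ∀ x, Tendsto (fun n => J n x) atTop (𝓝 x) := fun x => by
    simp only [hJpow]
    refine tendsto_pow_apply (fun n => norm_mul_opExp_neg_one_le hS (by positivity) (hL1 n))
      (fun x => ?_) m x
    exact tendsto_apply_of_denseRange hSd
      (fun n => norm_mul_opExp_neg_one_le hS (by positivity) (hL1 n))
      tendsto_one_div_add_atTop_nhds_zero_nat
      (fun n => norm_mul_opExp_neg_one_sub_le hS (by positivity) (hL1 n)) x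
  have hSJ : ∀ n, Commute (S ^ m) (J n) := fun n =>
    (Commute.refl _).mul_right (commute_opExp ((hSL n).pow_left m) _)
  have hJJ : ∀ n k, Commute (J n) (J k) := fun n k =>
    (hSJ k).mul_left (Commute.mul_right (commute_opExp ((hSL n).pow_left m) _).symm
      (commute_opExp (commute_opExp (hLL n k).symm _).symm _))
  set K : ℝ := Real.exp 1 * (2 * 3 ^ (m ^ 2)) with hK
  have hK0 : 0 < K := by positivity
  refine ⟨K, hK0, fun τ hτ f u hf hu huf j hj => ?_⟩
  set μ := volume.restrict (Ioo 0 τ)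
  have hm0 : (0 : ℝ) < m := by exact_mod_cast hm
  have hjm : (j : ℝ) + 1 ≤ m := by exact_mod_cast hj
  have hθ : (0 : ℝ) ≤ 1 - (2 * j + 1) / (2 * m) := by
    rw [sub_nonneg, div_le_one (by positivity)]; linarith
  have hθ' : (1 : ℝ) - (2 * j + 1) / (2 * m) ≤ 1 := by
    rw [sub_le_self_iff]; positivity
  set θ : ℝ := 1 - (2 * j + 1) / (2 * m) with hθdef
  have est : ∀ (v : ℕ → ℝ → H) (h : ℝ → H), IsChain m τ v → MemLp h 2 μ →
      (v 0 =ᵐ[μ] fun s => (S ^ m) (h s)) → ∀ n, ∀ t ∈ Icc 0 τ, interpNorm ι θ (J n (v j t)) ≤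
      ENNReal.ofReal (K * max (eLpNorm h 2 μ).toReal (eLpNorm (v m) 2 μ).toReal) := by
    -- The energy estimate concerns the right end point, so it is applied on `(0, t)`; its constant
    -- does not depend on the length of the interval.
    intro v h hv hh hvh n t ht
    have hμ : volume.restrict (Ioo 0 t) ≤ μ :=
      Measure.restrict_mono (Ioo_subset_Ioo_right ht.2) le_rfl
    refine ((hv.mono ht.2).interpNorm_regularized_le hm (hL n) (hSL n) hW hιW (hJ n) ht.1
      (hh.mono_measure hμ) (ae_mono hμ hvh) hj).trans ?_
    rw [hK, mul_assoc (Real.exp 1)]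
    refine ENNReal.ofReal_le_ofReal (mul_le_mul_of_nonneg_left (mul_le_mul_of_nonneg_left
      (max_le_max ?_ ?_) (by positivity)) (Real.exp_pos 1).le) <;>
      refine ENNReal.toReal_mono ?_ (eLpNorm_mono_measure _ hμ)
    · exact hh.2.ne
    · exact hv.memLp.2.ne
  set h : ℝ → H := fun s => U (f s)
  have hh : MemLp h 2 μ := U.comp_memLp' hf
  have huh : u 0 =ᵐ[μ] fun s => (S ^ m) (h s) := by
    filter_upwards [huf] with s hs
    rw [hs, hSU]
  set T : ℕ → H →L[ℂ] H := fun n => 1 - J n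
  have hT : ∀ n x, ‖T n x‖ ≤ 2 * ‖x‖ := fun n x => by
    have := (norm_sub_le x (J n x)).trans (add_le_add le_rfl (hJ n x))
    rw [two_mul]
    exact this
  have hT0 : ∀ x, Tendsto (fun n => T n x) atTop (𝓝 0) := fun x => by
    simpa [T] using (hJ1 x).const_sub x
  -- The bound from `est` for the chain `(1 - J_n) u`. It is independent of `t` and tends to `0` by
  -- dominated convergence.
  set δ : ℕ → ℝ := fun n => K * max (eLpNorm (fun s => T n (h s)) 2 μ).toReal
    (eLpNorm (fun s => T n (u m s)) 2 μ).toReal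
  have hδ0 : ∀ n, 0 ≤ δ n := fun n => by positivity
  have hδ : Tendsto δ atTop (𝓝 0) := by
    have h1 := tendsto_eLpNorm_apply_zero hh (T := fun n => (T n).restrictScalars ℝ) hT hT0
    have h2 := tendsto_eLpNorm_apply_zero hu.memLp (T := fun n => (T n).restrictScalars ℝ) hT hT0
    have h3 := (((ENNReal.tendsto_toReal ENNReal.zero_ne_top).comp h1).max
      ((ENNReal.tendsto_toReal ENNReal.zero_ne_top).comp h2)).const_mul K
    simpa using h3
  have hST : ∀ n, Commute (S ^ m) (T n) := fun n => (Commute.one_right _).sub_right (hSJ n)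
  have estT : ∀ n k, ∀ t ∈ Icc 0 τ, interpNorm ι θ (J n (T k (u j t))) ≤ ENNReal.ofReal (δ k) := by
    intro n k t ht
    refine est (fun j s => T k (u j s)) (fun s => T k (h s))
      (hu.map hτ.le ((T k).restrictScalars ℝ)) ((T k).comp_memLp' hh) ?_ n t ht
    filter_upwards [huh] with s hs
    rw [hs]
    exact congrArg (fun B : H →L[ℂ] H => B (h s)) (hST k).eq.symm
  have hcauchy : ∀ t ∈ Icc 0 τ, ∀ n k, interpNorm ι θ (J n (u j t) - J k (u j t)) ≤
      ENNReal.ofReal (δ n + δ k) := by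
    intro t ht n k
    -- Since `J_n` and `J_k` commute, the cross terms cancel; each remaining term is a regularized
    -- value of a small chain.
    have e : J n (u j t) - J k (u j t) = J n (T k (u j t)) - J k (T n (u j t)) := by
      have := congrArg (fun B : H →L[ℂ] H => B (u j t)) (hJJ n k).eq
      simp only [mul_apply_eq_comp] at this
      simp only [T, sub_apply, one_apply_eq_self, map_sub, this]
      abel
    rw [e, add_comm, ENNReal.ofReal_add (hδ0 _) (hδ0 _)]
    exact (interpNorm_sub_le _ _).trans (add_le_add (estT n k t ht) (estT k n t ht))
  have happrox : ∀ t ∈ Icc 0 τ, ∀ n, ∀ η : ℝ, 0 < η →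
      interpNorm ι θ (J n (u j t) - u j t) ≤ ENNReal.ofReal (δ n + η) := fun t ht n η hη =>
    interpNorm_sub_le_of_tendsto hθ hθ' hδ0 hδ (hcauchy t ht) (hJ1 (u j t)) n hη
  have hsmall : ∀ η : ℝ, 0 < η → ∃ n, ∀ t ∈ Icc 0 τ,
      interpNorm ι θ (J n (u j t) - u j t) ≤ ENNReal.ofReal η := fun η hη => by
    obtain ⟨n, hn⟩ := (hδ.eventually_lt_const (show 0 < η / 2 by positivity)).exists
    exact ⟨n, fun t ht => (happrox t ht n (η / 2) (by positivity)).trans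
      (ENNReal.ofReal_le_ofReal (by linarith))⟩
  have hbound : ∀ t ∈ Icc 0 τ, interpNorm ι θ (u j t) ≤ ENNReal.ofReal K *
      max (eLpNorm f 2 μ) (eLpNorm (u m) 2 μ) := by
    intro t ht
    have h1 : ENNReal.ofReal (K * max (eLpNorm h 2 μ).toReal (eLpNorm (u m) 2 μ).toReal) ≤
        ENNReal.ofReal K * max (eLpNorm f 2 μ) (eLpNorm (u m) 2 μ) := by
      rw [ENNReal.ofReal_mul hK0.le, ENNReal.ofReal_max, ENNReal.ofReal_toReal hh.2.ne,
        ENNReal.ofReal_toReal hu.memLp.2.ne]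
      gcongr
      exact eLpNorm_mono fun s => hU _
    refine le_trans ?_ h1
    refine ENNReal.le_of_forall_pos_le_add fun η hη _ => ?_
    obtain ⟨n, hn⟩ := hsmall η hη
    have e : u j t = J n (u j t) - (J n (u j t) - u j t) := by abel
    rw [e]
    refine (interpNorm_sub_le _ _).trans (add_le_add (est u h hu hh huh n t ht) ?_)
    exact (hn t ht).trans_eq ENNReal.ofReal_coe_nnreal
  refine ⟨fun t ht => ⟨(hbound t ht).trans_lt ?_, ?_⟩, hbound⟩
  · exact ENNReal.mul_lt_top ENNReal.ofReal_lt_top (max_lt hf.2 hu.memLp.2)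
  · rw [ENNReal.tendsto_nhds_zero]
    intro ε hε
    obtain ⟨η, hη, hηε⟩ : ∃ η : ℝ, 0 < η ∧ ENNReal.ofReal (3 * η) ≤ ε := by
      rcases eq_or_ne ε ⊤ with rfl | hε'
      · exact ⟨1, one_pos, le_top⟩
      · refine ⟨ε.toReal / 3, div_pos (ENNReal.toReal_pos hε.ne' hε') (by norm_num), ?_⟩
        rw [mul_div_cancel₀ _ (by norm_num), ENNReal.ofReal_toReal hε']
    obtain ⟨n, hn⟩ := hsmall η hη
    have hlim : Tendsto (fun s => Real.exp 1 * ‖opExp (L n) (-(θ * m)) (u j s - u j t)‖)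
        (𝓝[Icc 0 τ] t) (𝓝 0) := by
      have h1 : Tendsto (fun s => u j s - u j t) (𝓝[Icc 0 τ] t) (𝓝 0) := by
        simpa using ((hu.continuousOn hτ.le hj) t ht).sub_const (u j t)
      have h2 := ((((opExp (L n) (-(θ * m))).continuous.tendsto 0).comp h1).norm).const_mul
        (Real.exp 1)
      simpa using h2
    filter_upwards [hlim.eventually_lt_const hη, self_mem_nhdsWithin] with s hs hsm
    -- A uniform limit argument: `J_n u_j` is continuous into the interpolation space because `J_n`
    -- maps `H` boundedly into it, and `J_n u_j - u_j` is small uniformly in time.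
    have e : u j s - u j t = J n (u j s - u j t) -
        ((J n (u j s) - u j s) - (J n (u j t) - u j t)) := by rw [map_sub]; abel
    rw [e]
    refine (interpNorm_sub_le _ _).trans (le_trans ?_ hηε)
    rw [show 3 * η = η + (η + η) by ring, ENNReal.ofReal_add hη.le (by positivity),
      ENNReal.ofReal_add hη.le hη.le]
    refine add_le_add ?_ ((interpNorm_sub_le _ _).trans (add_le_add (hn s hsm) (hn t ht)))
    refine (interpNorm_regularized_le (hL n) (hSL n) hW hιW (hJ n) hθ hθ' _).trans ?_
    exact ENNReal.ofReal_le_ofReal hs.le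

end Core
-- Complexification and the main theorem
noncomputable section

namespace Complexify

variable {E : Type u} [NormedAddCommGroup E]

theorem norm_mk_zero (x : E) : ‖mk x (0 : E)‖ = ‖x‖ := by
  refine (sq_eq_sq₀ (norm_nonneg _) (norm_nonneg _)).1 ?_
  rw [norm_sq]
  change ‖x‖ ^ 2 + ‖(0 : E)‖ ^ 2 = _
  simp

variable [InnerProductSpace ℝ E]

/-- The norm of the complexification is Hilbertian, so the complex trace estimate applies to the
complexified couple. -/
instance : InnerProductSpace ℂ (Complexify E) where
  inner p q := ⟨inner ℝ (re p) (re q) + inner ℝ (im p) (im q),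
    inner ℝ (re p) (im q) - inner ℝ (im p) (re q)⟩
  norm_sq_eq_re_inner p := by
    rw [norm_sq, ← real_inner_self_eq_norm_sq, ← real_inner_self_eq_norm_sq]; rfl
  conj_inner_symm p q := by
    apply Complex.ext
    · simp [real_inner_comm]
    · simp [real_inner_comm]
  add_left p q r := by
    apply Complex.ext
    · simp only [re_add, im_add, inner_add_left, Complex.add_re]; ring
    · simp only [re_add, im_add, inner_add_left, Complex.add_im]; ring
  smul_left p q z := by
    apply Complex.ext
    · simp only [re_smul, im_smul, inner_add_left, inner_sub_left, real_inner_smul_left,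
        Complex.mul_re, Complex.conj_re, Complex.conj_im]
      ring
    · simp only [re_smul, im_smul, inner_add_left, inner_sub_left, real_inner_smul_left,
        Complex.mul_im, Complex.conj_re, Complex.conj_im]
      ring

instance [CompleteSpace E] : CompleteSpace (Complexify E) :=
  inferInstanceAs (CompleteSpace (WithLp 2 (E × E)))

/-- The inclusion of a real Hilbert space into its complexification. -/
def incl : E →L[ℝ] Complexify E :=
  LinearMap.mkContinuous
    { toFun := fun x => mk x 0
      map_add' := fun x y => ext' rfl (add_zero (0 : E)).symm
      map_smul' := fun r x => by
        apply ext'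
        · change r • x = (r : ℂ).re • x - (r : ℂ).im • (0 : E)
          simp
        · change (0 : E) = (r : ℂ).re • (0 : E) + (r : ℂ).im • x
          simp }
    1 fun x => by rw [one_mul]; exact (norm_mk_zero x).le

variable {F : Type v} [NormedAddCommGroup F] [InnerProductSpace ℝ F]

theorem map_incl (L : F →L[ℝ] E) (x : F) : map L (incl x) = incl (L x) :=
  ext' rfl (map_zero L)

theorem denseRange_map {L : F →L[ℝ] E} (hL : DenseRange L) : DenseRange (map L) := by
  have h1 : DenseRange fun p : E × E => mk p.1 p.2 :=
    Function.Surjective.denseRange fun p => ⟨(re p, im p), rfl⟩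
  have h2 := h1.comp (hL.prodMap hL) (WithLp.prod_continuous_toLp 2 E E)
  exact h2.mono (by rintro _ ⟨p, rfl⟩; exact ⟨mk p.1 p.2, rfl⟩)

end Complexify

end

end TimeTrace

open TimeTrace
/-- Let `V ↪ H` be (complex, or real) Hilbert spaces with `V` dense in `H`, and `m ≥ 1`.  There is
a constant `k > 0`, not depending on `τ`, such that for all `τ > 0`, `f ∈ ₀Z^m(0, τ)` and
`j = 0, …, m - 1`, the derivative `d^j f / dt^j` is in `C([0, τ]; [H, V]_{1 - (2 j + 1) / (2 m)})`
and its supremum norm there is at most `k` times the norm of `f` in `Z^m(0, τ)`. -/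
theorem mainTheorem10 (m : ℕ) (hm : 1 ≤ m) :
    (∀ (H : Type u) (V : Type v)
      [NormedAddCommGroup H] [InnerProductSpace ℂ H] [CompleteSpace H]
      [NormedAddCommGroup V] [InnerProductSpace ℂ V] [CompleteSpace V]
      (ι : V →L[ℂ] H), Function.Injective ι → DenseRange ι →
      ∃ k : ℝ, 0 < k ∧ ∀ τ : ℝ, 0 < τ → ∀ f : ℝ → V, MemZeroZ (ι.restrictScalars ℝ) m τ f →
        ∀ j < m, ∃ w : ℝ → H, IsContinuousDeriv (ι.restrictScalars ℝ) j τ f w ∧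
          ContinuousInto (interpNorm ι (1 - (2 * j + 1) / (2 * m))) τ w ∧
          (⨆ t ∈ Icc 0 τ, interpNorm ι (1 - (2 * j + 1) / (2 * m)) (w t)) ≤
            ENNReal.ofReal k * zNorm (ι.restrictScalars ℝ) m τ f) ∧
    (∀ (H : Type u) (V : Type v)
      [NormedAddCommGroup H] [InnerProductSpace ℝ H] [CompleteSpace H]
      [NormedAddCommGroup V] [InnerProductSpace ℝ V] [CompleteSpace V]
      (ι : V →L[ℝ] H), Function.Injective ι → DenseRange ι →
      ∃ k : ℝ, 0 < k ∧ ∀ τ : ℝ, 0 < τ → ∀ f : ℝ → V, MemZeroZ ι m τ f →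
        ∀ j < m, ∃ w : ℝ → H, IsContinuousDeriv ι j τ f w ∧
          ContinuousInto (realInterpNorm ι (1 - (2 * j + 1) / (2 * m))) τ w ∧
          (⨆ t ∈ Icc 0 τ, realInterpNorm ι (1 - (2 * j + 1) / (2 * m)) (w t)) ≤
            ENNReal.ofReal k * zNorm ι m τ f) := by
  constructor
  · intro H V _ _ _ _ _ _ ι _ hι
    obtain ⟨k, hk, hkey⟩ := exists_interpNorm_le hι hm
    refine ⟨k, hk, fun τ hτ f hf j hj => ?_⟩
    obtain ⟨u, hu, hw⟩ := hf.exists_chain hτ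
    have hu0 := (hw 0 (Nat.zero_le m)).ae_eq (isWeakDeriv_zero (hw 0 (Nat.zero_le m)).1)
    obtain ⟨h1, h2⟩ := hkey τ hτ f u hf.1.1 hu hu0 j hj
    have hz := eLpNorm_le_zNorm (hw m le_rfl)
    refine ⟨u j, ⟨hu.continuousOn hτ.le hj, hw j hj.le⟩, h1, iSup₂_le fun t ht => ?_⟩
    exact (h2 t ht).trans (by gcongr; exact max_le hz.1 hz.2)
  · intro H V _ _ _ _ _ _ ι _ hι
    have hd : DenseRange (Complexify.map ι) := Complexify.denseRange_map hι
    obtain ⟨k, hk, hkey⟩ := exists_interpNorm_le (ι := Complexify.map ι) hd hm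
    refine ⟨k, hk, fun τ hτ f hf j hj => ?_⟩
    obtain ⟨u, hu, hw⟩ := hf.exists_chain hτ
    have hu0 := (hw 0 (Nat.zero_le m)).ae_eq (isWeakDeriv_zero (hw 0 (Nat.zero_le m)).1)
    -- The inclusion is real-linear and isometric and intertwines `ι` with its complexification. The
    -- included derivatives therefore form a chain with the same `L²` norms.
    obtain ⟨h1, h2⟩ := hkey τ hτ (fun t => Complexify.incl (f t))
      (fun i t => Complexify.incl (u i t)) (Complexify.incl.comp_memLp' hf.1.1)
      (hu.map hτ.le Complexify.incl) (by
        filter_upwards [hu0] with t ht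
        rw [ht, Complexify.map_incl]) j hj
    have hz := eLpNorm_le_zNorm (hw m le_rfl)
    refine ⟨u j, ⟨hu.continuousOn hτ.le hj, hw j hj.le⟩, fun t ht => ⟨(h1 t ht).1, ?_⟩,
      iSup₂_le fun t ht => (h2 t ht).trans ?_⟩
    · have := (h1 t ht).2
      simp only [← map_sub] at this
      exact this
    · gcongr
      refine max_le ?_ ?_
      · exact (eLpNorm_congr_norm_ae (Eventually.of_forall fun t =>
          Complexify.norm_mk_zero (f t))).trans_le hz.1
      · exact (eLpNorm_congr_norm_ae (Eventually.of_forall fun t =>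
          Complexify.norm_mk_zero (u m t))).trans_le hz.2
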